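/- A stationary renewal process is a stationary $\{0,1\}$-valued process $X=(X_n)_{n\in\mathbb Z}$ that almost surely has infinitely many $1$'s in both directions and is such that, conditionally on $X_0=1$, the distances between consecutive $1$'s are independent and identically distributed; their common law, a distribution on the positive integers, is called the jump distribution. A random variable $T$ with values in $\{0,1,2,\dots\}\cup\{\infty\}$ (or its law) has exponential tails if there are constants $C,c>0$ with $\mathbb P(T\ge t)\le Ce^{-ct}$ for all integers $t\ge 1$; a distribution on the positive integers is non-lattice if its support is not contained in a proper subgroup of $\mathbb Z$. A process $X=(X_n)_{n\in\mathbb Z}$ is a finitary factor of a process $Y=(Y_n)_{n\in\mathbb Z}$ with coding window $R$ if there is a measurable function $\varphi$ with $X_n=\varphi\big((Y_{n+k})_{k\in\mathbb Z}\big)$ for all $n\in\mathbb Z$, and $R$ is an almost surely finite stopping time with respect to the filtration $(\mathcal F_r)_{r\ge 0}$, $\mathcal F_r=\sigma(Y_n:|n|\le r)$, such that $X_0$ is $\mathcal F_R$-measurable. **Theorem.** Let $X=(X_n)_{n\in\mathbb Z}$ be a stationary renewal process whose jump distribution is non-lattice and has exponential tails. Then $X$ is a finitary factor of an i.i.d.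 process with a coding window which has exponential tails. That is, on some probability space there are an i.i.d. process $Y=(Y_n)_{n\in\mathbb Z}$ with values in a standard Borel space and a process $X'$ with the same law as $X$ such that $X'$ is a finitary factor of $Y$ with a coding window $R$ that has exponential tails. -/

import Mathlib

open MeasureTheory ProbabilityTheory

noncomputable section

/-- The process `X = (X n)`, indexed by `ℤ`, is stationary: the law of the whole process is
invariant under every translation of time. -/
def IsStationaryProcess {Ω B : Type*} [MeasurableSpace Ω] [MeasurableSpace B]
    (X : ℤ → Ω → B) (μ : Measure Ω) : Prop :=
  ∀ m : ℤ, IdentDistrib (fun ω (n : ℤ) => X (n + m) ω) (fun ω (n : ℤ) => X n ω) μ μ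

/-- The variables `Y i` are independent and identically distributed. -/
def IsIID {ι Ω A : Type*} [MeasurableSpace Ω] [MeasurableSpace A]
    (Y : ι → Ω → A) (P : Measure Ω) : Prop :=
  iIndepFun Y P ∧ ∀ i j, IdentDistrib (Y i) (Y j) P P

/-- The position of the `k`-th `1` of `X` (counted from `k = 0`) in the half-line `{0, 1, 2, …}`,
whenever `X` has infinitely many `1`s there. -/
def onePos {Ω : Type*} (X : ℤ → Ω → Fin 2) (k : ℕ) (ω : Ω) : ℕ :=
  Nat.nth (fun n : ℕ => X (n : ℤ) ω = 1) k

/-- The distance between the `k`-th and the `(k+1)`-st `1` of `X` in `{0, 1, 2, …}`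
(the positions are increasing, so the subtraction does not truncate). -/
def jump {Ω : Type*} (X : ℤ → Ω → Fin 2) (k : ℕ) (ω : Ω) : ℕ :=
  onePos X (k + 1) ω - onePos X k ω

/-- `X` is a stationary renewal process with jump distribution `ν`: a stationary process with
values in `{0, 1}`, with infinitely many `1`s in both directions, such that, given that there is a
`1` at the origin, the distances between consecutive `1`s starting from the origin are independent
with common law `ν`.  (By stationarity the origin may be replaced by any other time.  Conditioning
on a `1` removes the size bias of the block that contains a fixed time.) -/
structure IsStationaryRenewalProcess {Ω : Type*} [MeasurableSpace Ω]
    (X : ℤ → Ω → Fin 2) (ν : Measure ℕ) (μ : Measure Ω) : Prop where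
  measurable : ∀ n, Measurable (X n)
  stationary : IsStationaryProcess X μ
  recurrent : ∀ᵐ ω ∂μ, ∀ m : ℤ, (∃ n, m < n ∧ X n ω = 1) ∧ (∃ n, n < m ∧ X n ω = 1)
  iIndepFun_jump : iIndepFun (fun k : ℕ => jump X k) (cond μ {ω | X 0 ω = 1})
  hasLaw_jump : ∀ k : ℕ, HasLaw (jump X k) ν (cond μ {ω | X 0 ω = 1})

/-- The support of the distribution `ν` is not contained in a proper subgroup of `ℤ`. -/
def IsNonLattice (ν : Measure ℕ) : Prop :=
  ∀ H : AddSubgroup ℤ, (∀ t : ℕ, ν {t} ≠ 0 → (t : ℤ) ∈ H) → H = ⊤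

/-- The random variable `T`, with values in `{0, 1, 2, …, ∞}`, has exponential tails. -/
def HasExponentialTails {Ω : Type*} [MeasurableSpace Ω] (T : Ω → WithTop ℕ) (P : Measure Ω) :
    Prop :=
  ∃ C c : ℝ, 0 < C ∧ 0 < c ∧
    ∀ t : ℕ, 1 ≤ t → P.real {ω | (t : WithTop ℕ) ≤ T ω} ≤ C * Real.exp (-c * t)

/-- The filtration whose `r`-th σ-algebra is generated by the variables `Y n` with `|n| ≤ r`. -/
def windowFiltration {Ω A : Type*} [mΩ : MeasurableSpace Ω] [mA : MeasurableSpace A]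
    (Y : ℤ → Ω → A) (hY : ∀ n, Measurable (Y n)) : Filtration ℕ mΩ where
  seq r := ⨆ (n : ℤ) (_ : |n| ≤ (r : ℤ)), mA.comap (Y n)
  mono' _ _ hrs := iSup₂_mono' fun n hn => ⟨n, hn.trans (by exact_mod_cast hrs), le_rfl⟩
  le' _ := iSup₂_le fun n _ => (hY n).comap_le

/-- `X` is a factor of `Y`: for some measurable `φ`, each `X n` is the value of `φ` at the
sequence `Y` recentred at time `n`. -/
def IsFactor {Ω A B : Type*} [MeasurableSpace A] [MeasurableSpace B]
    (X : ℤ → Ω → B) (Y : ℤ → Ω → A) : Prop :=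
  ∃ φ : (ℤ → A) → B, Measurable φ ∧ ∀ (n : ℤ) (ω : Ω), X n ω = φ (fun k => Y (n + k) ω)

/-- `R` is a coding window for `X` in terms of `Y`: an almost surely finite stopping time for
the filtration of the windows of `Y`, such that `X 0` is measurable with respect to the
σ-algebra of events determined by time `R`. -/
def IsCodingWindow {Ω A B : Type*} [MeasurableSpace Ω] [MeasurableSpace A] [MeasurableSpace B]
    (P : Measure Ω) (X : ℤ → Ω → B) (Y : ℤ → Ω → A) (hY : ∀ n, Measurable (Y n))
    (R : Ω → WithTop ℕ) : Prop :=
  ∃ hR : IsStoppingTime (windowFiltration Y hY) R,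
    (∀ᵐ ω ∂P, R ω ≠ ⊤) ∧ Measurable[hR.measurableSpace] (X 0)

/-- `X` is (in law) a finitary factor of an i.i.d. process, with a coding window that has
exponential tails: on some probability space there are an i.i.d. process `Y`, with values in a
standard Borel space, and a copy `X'` of `X` that is a finitary factor of `Y` with such a coding
window `R`. -/
def IsFinitaryFactorOfIIDWithExponentialTails {Ω B : Type*} [MeasurableSpace Ω]
    [MeasurableSpace B] (X : ℤ → Ω → B) (μ : Measure Ω) : Prop :=
  ∃ (Ω' : Type) (_ : MeasurableSpace Ω') (P : Measure Ω') (_ : IsProbabilityMeasure P)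
    (A : Type) (_ : MeasurableSpace A) (_ : StandardBorelSpace A)
    (Y : ℤ → Ω' → A) (hY : ∀ n, Measurable (Y n)) (X' : ℤ → Ω' → B) (R : Ω' → WithTop ℕ),
    IsIID Y P ∧
    IdentDistrib (fun ω (n : ℤ) => X' n ω) (fun ω (n : ℤ) => X n ω) P μ ∧
    IsFactor X' Y ∧
    IsCodingWindow P X' Y hY R ∧
    HasExponentialTails R P

end

/-!
Every stationary renewal process `X` with non-lattice jumps of exponential tails is realised as the
fine process of a two-level renewal structure that is read off from an i.i.d. process.

*The coarse process.* For `K` large and `p` small there is a randomized stopping time at which the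
random walk with the jumps of `X` has exactly the law `1 + K + geometric(p)`
(`exists_geometric_embedding`). Such a stopping time exists as soon as the sequence
`m = (δ₀ - law) * u`, where `u` is the renewal sequence of the walk, is nonnegative: `m` is then the
expected number of visits before stopping. Nonnegativity follows from the renewal theorem with
exponential rate (`renewal_exponential_rate`), because `u` converges faster than the geometric tail
decays. The rate comes from complex analysis: the increments of `u` are the Taylor coefficients of
the inverse of the generating function of the jump tails, which has no zero in a neighbourhood of
the closed unit disc. So `X` should be a renewal process with jump law `1 + K + geometric(p)`, the
coarse process, whose blocks are filled by independent stopped walks.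

*The coding.* The coarse process is a function of independent coins: a coarse renewal takes place at
each head of the coin, except during the `K` sites after a coarse renewal. A head after `K` tails is
a marker, where a coarse renewal is certain, and after it the coarse process is determined by the
coins. The walk in a coarse block is generated backwards from the end of the block. Its backward
transition probabilities depend on the distance from the start of the block only, so that each site
can carry, independently, one backward step for every such distance. Hence the fine process at the
origin is a function of the sites from the last marker on its left to a head of the coin far enough
on its right, and the distance to these has a geometric tail
(`IsSiteLaw.hasExponentialTails_codingWindow`).

*The law.* Given the age `α` of a site in its coarse block, the gap to the last one of the fine
process before the site equals `c` with probability `m (α - c) * P(jump > c) / P(block > α)`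
(`IsSiteLaw.real_gap`); this solves a recursion in `α` whose solution is unique. It follows by
induction that the words of the fine process after a one have the probabilities of a renewal process
(`IsSiteLaw.real_wordSet`). By stationarity the words after a one determine the law of the process,
even if they are known only up to a common factor (`identDistrib_of_measure_one_wordAt`).
-/

/-! ### Coefficients of the inverse of a power series -/

theorem summable_norm_mul_pow_of_le {d : ℕ → ℂ} {C r : ℝ} (hr : 0 < r)
    (hd : ∀ n, ‖d n‖ * r ^ n ≤ C) :
    ∀ z : ℂ, ‖z‖ < r → Summable fun n => ‖d n * z ^ n‖ := by
  intro z hz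
  have hC : 0 ≤ C := le_trans (by positivity) (hd 0)
  refine Summable.of_nonneg_of_le (fun _ => norm_nonneg _) (fun n => ?_)
    ((summable_geometric_of_lt_one (r := ‖z‖ / r) (by positivity)
      ((div_lt_one hr).2 hz)).mul_left C)
  rw [norm_mul, norm_pow, div_pow, mul_div_assoc', le_div_iff₀ (by positivity)]
  nlinarith [hd n, pow_nonneg (norm_nonneg z) n]

/-- Power series that have the same sums near the origin coincide. -/
theorem coeff_eq_of_tsum_eq {d e : ℕ → ℂ} {F : ℂ → ℂ} {r : ℝ} (hr : 0 < r)
    (hd : ∀ z : ℂ, ‖z‖ < r → HasSum (fun n => d n * z ^ n) (F z))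
    (he : ∀ z : ℂ, ‖z‖ < r → HasSum (fun n => e n * z ^ n) (F z)) : d = e := by
  have key : ∀ c : ℕ → ℂ, (∀ z : ℂ, ‖z‖ < r → HasSum (fun n => c n * z ^ n) (F z)) →
      HasFPowerSeriesAt F (FormalMultilinearSeries.ofScalars ℂ c) 0 := by
    intro c hc
    rw [hasFPowerSeriesAt_iff]
    filter_upwards [Metric.ball_mem_nhds (0 : ℂ) hr] with z hz
    have := hc z (by simpa using hz)
    simpa [FormalMultilinearSeries.coeff_ofScalars, mul_comm] using this
  have := (key d hd).eq_formalMultilinearSeries (key e he)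
  exact FormalMultilinearSeries.ofScalars_series_injective ℂ ℂ this

/-- If the power series of `b` has a radius of convergence larger than `1` and no zero in the closed
unit disc, then by compactness it has no zero in a slightly larger disc, so that the Taylor
coefficients `d` of its inverse decay exponentially. They are the convolution inverse of `b`. -/
theorem exists_inverse_coeff {b : ℕ → ℝ} {C r : ℝ} (hr : 1 < r)
    (hb : ∀ n, |b n| * r ^ n ≤ C)
    (hne : ∀ z : ℂ, ‖z‖ ≤ 1 → ∑' n, (b n : ℂ) * z ^ n ≠ 0) :
    ∃ (d : ℕ → ℂ) (C' s : ℝ), 1 < s ∧ (∀ n, ‖d n‖ * s ^ n ≤ C') ∧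
      (∑' n, d n) * (∑' n, (b n : ℂ)) = 1 ∧
      ∀ n, ∑ x ∈ Finset.HasAntidiagonal.antidiagonal n, d x.1 * b x.2 = if n = 0 then 1 else 0 := by
  set F : ℂ → ℂ := fun z => ∑' n, (b n : ℂ) * z ^ n with hF
  have hr0 : 0 < r := by linarith
  have hsum := summable_norm_mul_pow_of_le (d := fun n => (b n : ℂ)) hr0
    (by simpa using hb)
  have hdiff : DifferentiableOn ℂ F (Metric.ball 0 r) := by
    have h1 : ∀ s : NNReal, 0 < s → (s : ℝ) < r →
        DifferentiableOn ℂ F (Metric.ball 0 s) := by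
      intro s hs0 hs
      refine Complex.differentiableOn_tsum_of_summable_norm (u := fun n => ‖(b n : ℂ)‖ * s ^ n) ?_ ?_
        Metric.isOpen_ball ?_
      · have := hsum (s : ℂ) (by simpa using hs)
        simpa using this
      · intro i; fun_prop
      · intro n z hz
        rw [norm_mul, norm_pow]
        have : ‖z‖ ≤ s := by simpa using (le_of_lt (by simpa using hz))
        gcongr
    intro z hz
    obtain ⟨s, hs1, hs2⟩ := exists_between (show ‖z‖ < r by simpa using hz)
    have hs0 : 0 < s := lt_of_le_of_lt (norm_nonneg _) hs1
    refine ((h1 ⟨s, hs0.le⟩ hs0 hs2).differentiableAt ?_).differentiableWithinAt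
    exact Metric.isOpen_ball.mem_nhds (mem_ball_zero_iff.2 hs1)
  have hopen : IsOpen (Metric.ball (0 : ℂ) r ∩ F ⁻¹' {0}ᶜ) :=
    hdiff.continuousOn.isOpen_inter_preimage Metric.isOpen_ball isOpen_compl_singleton
  obtain ⟨δ, hδ, hsub⟩ := (isCompact_closedBall (0 : ℂ) 1).exists_cthickening_subset_open hopen
    (fun z hz => ⟨by simp at hz ⊢; linarith, hne z (by simpa using hz)⟩)
  rw [cthickening_closedBall hδ.le zero_le_one] at hsub
  have hG : DifferentiableOn ℂ (fun z => (F z)⁻¹) (Metric.closedBall 0 (δ + 1)) :=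
    DifferentiableOn.inv (hdiff.mono fun z hz => (hsub hz).1) fun z hz => (hsub hz).2
  set R : NNReal := ⟨δ + 1, by positivity⟩ with hR
  have hps := DifferentiableOn.hasFPowerSeriesOnBall (R := R) hG (by
    rw [← NNReal.coe_pos]; show 0 < δ + 1; positivity)
  set P := cauchyPowerSeries (fun z => (F z)⁻¹) 0 R
  set d : ℕ → ℂ := fun n => P.coeff n with hd
  set s : NNReal := ⟨δ / 2 + 1, by positivity⟩ with hs
  have hsR : s < R := by
    rw [← NNReal.coe_lt_coe]; show δ / 2 + 1 < δ + 1; linarith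
  obtain ⟨C', hC', hPb⟩ := P.norm_mul_pow_le_of_lt_radius
    (lt_of_lt_of_le (by exact_mod_cast hsR) hps.r_le)
  have hdb : ∀ n, ‖d n‖ * (s : ℝ) ^ n ≤ C' := by
    intro n
    rw [hd]; simp only
    rw [← FormalMultilinearSeries.norm_apply_eq_norm_coef]
    exact hPb n
  have hs1 : (1 : ℝ) < s := by show 1 < δ / 2 + 1; linarith
  have hdsum := summable_norm_mul_pow_of_le (d := d) (r := s) (by linarith) hdb
  have hdhas : ∀ z : ℂ, ‖z‖ < s → ∑' n, d n * z ^ n = (F z)⁻¹ := by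
    intro z hz
    have := hps.hasSum (y := z) (by
      rw [Metric.eball_coe, Metric.mem_ball, dist_zero_right]
      exact hz.trans (by exact_mod_cast hsR))
    have h2 := this.tsum_eq
    rw [zero_add] at h2
    rw [← h2]
    refine tsum_congr fun n => ?_
    simp [hd, mul_comm]
  refine ⟨d, C', s, hs1, hdb, ?_, ?_⟩
  · have h1 := hdhas 1 (by simpa using hs1)
    simp only [one_pow, mul_one] at h1
    rw [h1]
    have h2 := hne 1 (by simp)
    simp only [hF, one_pow, mul_one] at h2 ⊢
    exact inv_mul_cancel₀ h2
  · have : (fun n => ∑ x ∈ Finset.HasAntidiagonal.antidiagonal n, d x.1 * (b x.2 : ℂ)) =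
        fun n => if n = 0 then 1 else 0 := by
      refine coeff_eq_of_tsum_eq (F := fun _ => 1) one_pos ?_ ?_
      · intro z hz
        have e1 := hdsum z (by linarith)
        have e2 := hsum z (by linarith)
        have h3 := (summable_norm_sum_mul_antidiagonal_of_summable_norm e1 e2).of_norm.hasSum
        rw [← tsum_mul_tsum_eq_tsum_sum_antidiagonal_of_summable_norm e1 e2,
          hdhas z (by linarith)] at h3
        rw [inv_mul_cancel₀ (hne z hz.le)] at h3
        refine (congrArg (fun f => HasSum f (1 : ℂ)) (funext fun n => ?_)).mp h3
        rw [Finset.sum_mul]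
        refine Finset.sum_congr rfl fun x hx => ?_
        rw [← Finset.HasAntidiagonal.mem_antidiagonal.1 hx, pow_add]; ring
      · intro z hz
        convert hasSum_ite_eq 0 (1 : ℂ) using 2 with n
        rcases eq_or_ne n 0 with rfl | h <;> simp [*]
    exact fun n => congrFun this n

/-! ### The renewal theorem with exponential rate -/

/-- The tails `1 - ∑_{k < n} v k` of a probability sequence. -/
def tailSeq (v : ℕ → ℝ) (n : ℕ) : ℝ := 1 - ∑ k ∈ Finset.range n, v k

theorem tailSeq_zero (v : ℕ → ℝ) : tailSeq v 0 = 1 := by simp [tailSeq]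

theorem tailSeq_succ (v : ℕ → ℝ) (n : ℕ) : tailSeq v (n + 1) = tailSeq v n - v n := by
  simp only [tailSeq, Finset.sum_range_succ]; ring

theorem tailSeq_nonneg {v : ℕ → ℝ} (hv : ∀ n, 0 ≤ v n) (hs : HasSum v 1) (n : ℕ) :
    0 ≤ tailSeq v n :=
  sub_nonneg.2 (sum_le_hasSum _ (fun i _ => hv i) hs)

/-- With `S` the generating function of the tails and `V` that of `v`, one has
`(1 - z) * S z = 1 - z * V z`. So at a zero of `S` in the closed unit disc the average `z * V z` of
the powers of `z` equals `1`, all these powers are `1`, and aperiodicity leaves `z = 1`, where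
`S` is positive. -/
theorem tailSeq_tsum_ne_zero {v : ℕ → ℝ} (hv : ∀ n, 0 ≤ v n) (hs : HasSum v 1)
    (hap : ∀ z : ℂ, (∀ k, v k ≠ 0 → z ^ (k + 1) = 1) → z = 1)
    {z : ℂ} (hz : ‖z‖ ≤ 1) (hsum : Summable (tailSeq v)) :
    ∑' n, (tailSeq v n : ℂ) * z ^ n ≠ 0 := by
  intro h0
  have hb := tailSeq_nonneg hv hs
  have hS : Summable fun n => (tailSeq v n : ℂ) * z ^ n := by
    refine Summable.of_norm_bounded hsum fun n => ?_
    rw [norm_mul, norm_pow, Complex.norm_real, Real.norm_of_nonneg (hb n)]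
    exact mul_le_of_le_one_right (hb n) (pow_le_one₀ (norm_nonneg _) hz)
  have h1 : HasSum (fun n => (tailSeq v n : ℂ) * z ^ n) 0 := h0 ▸ hS.hasSum
  have h2 : HasSum (fun n => (tailSeq v (n + 1) : ℂ) * z ^ (n + 1)) (-1) := by
    have := (hasSum_nat_add_iff' 1).2 h1
    simpa [tailSeq_zero] using this
  have h3 : HasSum (fun n => (v n : ℂ) * z ^ (n + 1)) 1 := by
    have := (h1.mul_left z).sub h2
    rw [mul_zero, zero_sub, neg_neg] at this
    refine (congrArg (fun f => HasSum f (1 : ℂ)) (funext fun n => ?_)).mp this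
    rw [tailSeq_succ]; push_cast; ring
  have h4 : HasSum (fun n => v n * (1 - (z ^ (n + 1)).re)) 0 := by
    have := hs.sub (Complex.hasSum_re h3)
    rw [Complex.one_re, sub_self] at this
    refine (congrArg (fun f => HasSum f (0 : ℝ)) (funext fun n => ?_)).mp this
    rw [Complex.re_ofReal_mul]; ring
  have hle : ∀ n, ‖z ^ (n + 1)‖ ≤ 1 := fun n => by
    rw [norm_pow]; exact pow_le_one₀ (norm_nonneg _) hz
  have h5 := (hasSum_zero_iff_of_nonneg (fun n => mul_nonneg (hv n)
    (sub_nonneg.2 ((Complex.re_le_norm _).trans (hle n))))).1 h4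
  have hz1 : z = 1 := hap z fun k hk => by
    have h6 : (z ^ (k + 1)).re = 1 := by
      have := congrFun h5 k
      simp only [Pi.zero_apply, mul_eq_zero, hk, false_or] at this
      linarith
    have h7 : (z ^ (k + 1)).im = 0 := by
      have := hle k
      have h8 := Complex.sq_norm (z ^ (k + 1))
      rw [Complex.normSq_apply, h6] at h8
      nlinarith [norm_nonneg (z ^ (k + 1))]
    exact Complex.ext h6 h7
  subst hz1
  have h9 : HasSum (tailSeq v) 0 := by simpa using Complex.hasSum_re h1
  have := (hasSum_zero_iff_of_nonneg hb).1 h9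
  have := congrFun this 0
  simp [tailSeq_zero] at this

/-- **Renewal theorem with exponential rate.** If the increments of an aperiodic renewal sequence
have exponentially small tails, then its renewal probabilities converge exponentially fast to a
positive limit. Here `v n` is the probability of the increment `n + 1`, and the renewal
probabilities are the coefficients of `U`. -/
theorem renewal_exponential_rate {v : ℕ → ℝ} (hv : ∀ n, 0 ≤ v n) (hs : HasSum v 1)
    (hap : ∀ z : ℂ, (∀ k, v k ≠ 0 → z ^ (k + 1) = 1) → z = 1) {C r : ℝ} (hr : 1 < r)
    (htail : ∀ n, tailSeq v n * r ^ n ≤ C) {U : PowerSeries ℝ}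
    (hU : U * (1 - PowerSeries.X * PowerSeries.mk v) = 1) :
    ∃ l D t : ℝ, 0 < l ∧ 0 < D ∧ 0 < t ∧ t < 1 ∧
      ∀ n, |PowerSeries.coeff n U - l| ≤ D * t ^ n := by
  have hb := tailSeq_nonneg hv hs
  have htail' : ∀ n, |tailSeq v n| * r ^ n ≤ C := fun n => by rw [abs_of_nonneg (hb n)]; exact htail n
  have hsum : Summable (tailSeq v) := by
    have := summable_norm_mul_pow_of_le (d := fun n => (tailSeq v n : ℂ)) (r := r)
      (by linarith) (by simpa using htail') 1 (by simpa using hr)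
    simpa [abs_of_nonneg (hb _)] using this
  obtain ⟨d, C', s, hs1, hd, hone, hconv⟩ := exists_inverse_coeff hr htail'
    fun z hz => tailSeq_tsum_ne_zero hv hs hap hz hsum
  have hdsum : Summable fun n => ‖d n‖ := by
    simpa using summable_norm_mul_pow_of_le (d := d) (r := s) (by linarith) hd 1
      (by simpa using hs1)
  have hC' : 0 ≤ C' := le_trans (by positivity) (hd 0)
  -- the coefficients of `U` are the partial sums of `d`
  have hB : (1 - PowerSeries.X) * PowerSeries.mk (fun n => (tailSeq v n : ℂ)) =
      1 - PowerSeries.X * PowerSeries.mk (fun n => (v n : ℂ)) := by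
    ext n
    cases n with
    | zero => simp [tailSeq_zero]
    | succ n => simp [sub_mul, PowerSeries.coeff_succ_X_mul, PowerSeries.coeff_one, tailSeq_succ]
  have hDB : PowerSeries.mk d * PowerSeries.mk (fun n => (tailSeq v n : ℂ)) = 1 := by
    ext n
    rw [PowerSeries.coeff_mul, PowerSeries.coeff_one]
    simpa using hconv n
  have hUc : U.map Complex.ofRealHom *
      (1 - PowerSeries.X * PowerSeries.mk (fun n => (v n : ℂ))) = 1 := by
    have := congrArg (PowerSeries.map Complex.ofRealHom) hU
    rw [map_mul, map_sub, map_mul, map_one, PowerSeries.map_X] at this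
    exact this
  have hUd : U.map Complex.ofRealHom = PowerSeries.mk 1 * PowerSeries.mk d := by
    have h1 : PowerSeries.mk 1 * PowerSeries.mk d *
      (1 - PowerSeries.X * PowerSeries.mk (fun n => (v n : ℂ))) = 1 := by
      rw [← hB]
      calc _ = (PowerSeries.mk 1 * (1 - PowerSeries.X)) * (PowerSeries.mk d *
            PowerSeries.mk (fun n => (tailSeq v n : ℂ))) := by ring
        _ = 1 := by rw [hDB, PowerSeries.mk_one_mul_one_sub_eq_one, one_mul]
    calc _ = U.map Complex.ofRealHom * (PowerSeries.mk 1 * PowerSeries.mk d *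
      (1 - PowerSeries.X * PowerSeries.mk (fun n => (v n : ℂ)))) := by rw [h1, mul_one]
      _ = PowerSeries.mk 1 * PowerSeries.mk d * (U.map Complex.ofRealHom *
      (1 - PowerSeries.X * PowerSeries.mk (fun n => (v n : ℂ)))) := by ring
      _ = _ := by rw [hUc, mul_one]
  have hcoeff : ∀ n, ((PowerSeries.coeff n U : ℝ) : ℂ) = ∑ k ∈ Finset.range (n + 1), d k := by
    intro n
    have := congrArg (PowerSeries.coeff n) hUd
    rw [mul_comm, PowerSeries.coeff_map, PowerSeries.coeff_mul,
      Finset.Nat.sum_antidiagonal_eq_sum_range_succ_mk] at this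
    simp only [PowerSeries.coeff_mk, Pi.one_apply, mul_one] at this
    exact this
  set w : ℝ := ∑' n, tailSeq v n with hw
  have hw0 : 1 ≤ w := by
    have := hsum.sum_le_tsum {0} (fun i _ => hb i)
    simpa [tailSeq_zero] using this
  have hlim : ∑' n, d n = ((w⁻¹ : ℝ) : ℂ) := by
    rw [← Complex.ofReal_tsum] at hone
    rw [Complex.ofReal_inv]
    exact eq_inv_of_mul_eq_one_left hone
  have hgeo := summable_geometric_of_lt_one (r := s⁻¹) (by positivity) (inv_lt_one_of_one_lt₀ hs1)
  refine ⟨w⁻¹, (C' + 1) * (1 - s⁻¹)⁻¹, s⁻¹, by positivity, ?_, by positivity,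
    inv_lt_one_of_one_lt₀ hs1, fun n => ?_⟩
  · have := inv_lt_one_of_one_lt₀ hs1
    have : 0 < 1 - s⁻¹ := by linarith
    positivity
  · have h1 : ‖((PowerSeries.coeff n U - w⁻¹ : ℝ) : ℂ)‖ = ‖∑' k, d (k + (n + 1))‖ := by
      rw [Complex.ofReal_sub, hcoeff, ← hlim, ← hdsum.of_norm.sum_add_tsum_nat_add (n + 1),
        sub_add_cancel_left, norm_neg]
    rw [Complex.norm_real, Real.norm_eq_abs] at h1
    rw [h1]
    have h2 : ∀ k, ‖d (k + (n + 1))‖ ≤ (C' + 1) * s⁻¹ ^ n * s⁻¹ ^ k := by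
      intro k
      have h3 := hd (k + (n + 1))
      rw [← le_div_iff₀ (by positivity)] at h3
      refine h3.trans ?_
      rw [mul_assoc, ← pow_add, inv_pow, ← div_eq_mul_inv]
      exact div_le_div₀ (by linarith) (by linarith) (by positivity)
        (pow_le_pow_right₀ hs1.le (by omega))
    refine (tsum_of_norm_bounded (hgeo.mul_left _).hasSum h2).trans ?_
    rw [tsum_mul_left, tsum_geometric_of_lt_one (by positivity) (inv_lt_one_of_one_lt₀ hs1)]
    apply le_of_eq; ring

/-! ### Embedding a shifted geometric law into a random walk -/

/-- The law of `K + G` at `n`, for `G` geometric on `{0, 1, …}` with success probability `p`. -/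
def geomMass (K : ℕ) (p : ℝ) (n : ℕ) : ℝ := if K ≤ n then p * (1 - p) ^ (n - K) else 0

/-- The tail `P(K + G ≥ n)`, for `G` geometric on `{0, 1, …}` with success probability `p`.
The truncation of `n - K` is intended: for `n ≤ K` the value is `1`. -/
def geomTail (K : ℕ) (p : ℝ) (n : ℕ) : ℝ := (1 - p) ^ (n - K)

theorem geomTail_succ (K : ℕ) (p : ℝ) (n : ℕ) :
    geomTail K p (n + 1) = geomTail K p n - geomMass K p n := by
  unfold geomTail geomMass
  split_ifs with h
  · rw [Nat.sub_add_comm h, pow_succ]; ring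
  · rw [Nat.sub_eq_zero_of_le (by omega), Nat.sub_eq_zero_of_le (by omega), sub_zero]

theorem geomMass_eq (K : ℕ) (p : ℝ) (n : ℕ) :
    geomMass K p n = (if K ≤ n then p else 0) * geomTail K p n := by
  unfold geomTail geomMass
  split_ifs <;> simp

theorem geomTail_succ_mul (K : ℕ) (p : ℝ) (n : ℕ) :
    geomTail K p (n + 1) = (1 - if K ≤ n then p else 0) * geomTail K p n := by
  rw [geomTail_succ, geomMass_eq]; ring

theorem geomTail_pos {K : ℕ} {p : ℝ} (hp : p < 1) (n : ℕ) : 0 < geomTail K p n :=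
  pow_pos (by linarith) _

theorem renewal_coeff_nonneg {v : ℕ → ℝ} (hv : ∀ n, 0 ≤ v n) {U : PowerSeries ℝ}
    (hU : U * (1 - PowerSeries.X * PowerSeries.mk v) = 1) (n : ℕ) :
    0 ≤ PowerSeries.coeff n U := by
  have hU' : U = 1 + PowerSeries.X * (PowerSeries.mk v * U) := by
    linear_combination hU
  induction n using Nat.strong_induction_on with
  | _ n ih =>
    cases n with
    | zero => rw [hU']; simp
    | succ n =>
      rw [hU', map_add, PowerSeries.coeff_succ_X_mul, PowerSeries.coeff_mul,
        PowerSeries.coeff_one, if_neg (by omega), zero_add]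
      refine Finset.sum_nonneg fun x hx => mul_nonneg (by simpa using hv _) (ih _ ?_)
      have := Finset.HasAntidiagonal.mem_antidiagonal.1 hx
      omega

/-- **Embedding of a shifted geometric law into a random walk.** Consider the walk started at `0`
whose increment is `n + 1` with probability `v n`. For `K` large and `p` small it has a randomized
stopping time at which its law is that of `1 + K + G` with `G` geometric, and `m n` is the expected
number of visits to `n` strictly before that time: a visit to `n + 1` comes from an unstopped visit
to some `x ≤ n`, and either goes on or stops. The point is the nonnegativity of `m`, which holds
because the error in the renewal theorem decays faster than the geometric tail. -/
theorem exists_geometric_embedding {v : ℕ → ℝ} (hv : ∀ n, 0 ≤ v n) (hs : HasSum v 1)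
    (hap : ∀ z : ℂ, (∀ k, v k ≠ 0 → z ^ (k + 1) = 1) → z = 1) {C r : ℝ} (hr : 1 < r)
    (htail : ∀ n, tailSeq v n * r ^ n ≤ C) :
    ∃ (K : ℕ) (p : ℝ) (m : ℕ → ℝ), 0 < p ∧ p < 1 ∧ m 0 = 1 ∧ (∀ n, 0 ≤ m n) ∧
      ∀ n, ∑ x ∈ Finset.HasAntidiagonal.antidiagonal n, m x.1 * v x.2 =
        m (n + 1) + geomMass K p n := by
  set W : PowerSeries ℝ := 1 - PowerSeries.X * PowerSeries.mk v with hW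
  have hU : W⁻¹ * W = 1 := PowerSeries.inv_mul_cancel _ (by simp [hW])
  set U := W⁻¹
  obtain ⟨l, D, t, hl, hD, ht0, ht1, hrate⟩ := renewal_exponential_rate hv hs hap hr htail hU
  obtain ⟨K, hK⟩ : ∃ K : ℕ, t ^ K < l / (2 * D) := exists_pow_lt_of_lt_one (by positivity) ht1
  have hK' : D * t ^ K ≤ l / 2 := by
    rw [lt_div_iff₀ (by positivity)] at hK; linarith
  obtain ⟨p, hp0, hp1, hp2⟩ : ∃ p : ℝ, 0 < p ∧ p ≤ (1 - t) / 2 ∧ p ≤ l * (1 - t) / (4 * D) :=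
    have : 0 < 1 - t := by linarith
    ⟨min ((1 - t) / 2) (l * (1 - t) / (4 * D)), by positivity, min_le_left _ _, min_le_right _ _⟩
  have hqt : (1 - t) / 2 ≤ (1 - p) - t := by linarith
  have hq0 : 0 < 1 - p := by linarith
  have hp2' : p * D ≤ l / 2 * ((1 - p) - t) := by
    rw [le_div_iff₀ (by positivity)] at hp2
    nlinarith
  set M : PowerSeries ℝ := (1 - PowerSeries.X * PowerSeries.mk (geomMass K p)) * U with hM
  -- `M = (1 - X G) U` for the generating function `G` of `geomMass`
  refine ⟨K, p, fun n => PowerSeries.coeff n M, hp0, by linarith, ?_, ?_, ?_⟩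
  · have h1 : PowerSeries.constantCoeff U = 1 := by
      have := congrArg PowerSeries.constantCoeff hU
      simpa [hW] using this
    simp [hM, h1]
  · intro n
    have hUn := renewal_coeff_nonneg hv hU
    have hcoeff : ∀ n, PowerSeries.coeff (n + 1) M = PowerSeries.coeff (n + 1) U -
        ∑ i ∈ Finset.range (n + 1), geomMass K p i * PowerSeries.coeff (n - i) U := by
      intro n
      rw [hM, sub_mul, one_mul, map_sub, mul_assoc, PowerSeries.coeff_succ_X_mul,
        PowerSeries.coeff_mul, Finset.Nat.sum_antidiagonal_eq_sum_range_succ_mk]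
      simp
    cases n with
    | zero =>
      have := hUn 0
      simpa [hM] using this
    | succ n =>
      show 0 ≤ PowerSeries.coeff (n + 1) M
      rw [hcoeff]
      rcases lt_or_ge n K with hn | hn
      · rw [Finset.sum_eq_zero fun i hi => ?_, sub_zero]
        · exact hUn _
        · have := Finset.mem_range.1 hi
          rw [geomMass, if_neg (by omega), zero_mul]
      · obtain ⟨N, rfl⟩ := Nat.exists_eq_add_of_le hn
        have hsplit : ∑ i ∈ Finset.range (K + N + 1),
            geomMass K p i * PowerSeries.coeff (K + N - i) U =
            ∑ i ∈ Finset.range (N + 1), p * (1 - p) ^ i * PowerSeries.coeff (N - i) U := by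
          rw [add_assoc, Finset.sum_range_add, Finset.sum_eq_zero, zero_add]
          · refine Finset.sum_congr rfl fun i hi => ?_
            rw [geomMass, if_pos (by omega), Nat.add_sub_cancel_left, Nat.add_sub_add_left]
          · intro i hi
            have := Finset.mem_range.1 hi
            rw [geomMass, if_neg (by omega), zero_mul]
        rw [hsplit]
        have h1 : ∑ i ∈ Finset.range (N + 1), p * (1 - p) ^ i * PowerSeries.coeff (N - i) U ≤
            ∑ i ∈ Finset.range (N + 1), (l * (p * (1 - p) ^ i) +
              p * D * ((1 - p) ^ i * t ^ (N + 1 - 1 - i))) := by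
          refine Finset.sum_le_sum fun i _ => ?_
          have := (abs_le.1 (hrate (N - i))).2
          have hq := pow_pos hq0 i
          rw [Nat.add_sub_cancel]
          nlinarith [mul_le_mul_of_nonneg_left this (mul_pos hp0 hq).le]
        rw [Finset.sum_add_distrib, ← Finset.mul_sum, ← Finset.mul_sum, ← Finset.mul_sum] at h1
        have h2 := geom_sum₂_mul (1 - p) t (N + 1)
        have h3 := geom_sum_mul (1 - p) (N + 1)
        have h4 := (abs_le.1 (hrate (K + N + 1))).1
        have h5 : t ^ (N + 1) ≤ (1 - p) ^ (N + 1) := pow_le_pow_left₀ ht0.le (by linarith) _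
        have h6 : D * t ^ (K + N + 1) ≤ l / 2 * (1 - p) ^ (N + 1) := by
          rw [add_assoc, pow_add, ← mul_assoc]
          exact mul_le_mul hK' h5 (by positivity) (by positivity)
        have h7 : p * D * ∑ i ∈ Finset.range (N + 1), (1 - p) ^ i * t ^ (N + 1 - 1 - i) ≤
            l / 2 * (1 - p) ^ (N + 1) := by
          set S := ∑ i ∈ Finset.range (N + 1), (1 - p) ^ i * t ^ (N + 1 - 1 - i)
          have hS : 0 ≤ S := Finset.sum_nonneg fun i _ => by positivity
          calc p * D * S ≤ l / 2 * ((1 - p) - t) * S := by gcongr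
            _ = l / 2 * ((1 - p) ^ (N + 1) - t ^ (N + 1)) := by rw [← h2]; ring
            _ ≤ _ := by
              have : 0 ≤ t ^ (N + 1) := by positivity
              gcongr; linarith
        have h8 : l * (p * ∑ i ∈ Finset.range (N + 1), (1 - p) ^ i) = l * (1 - (1 - p) ^ (N + 1)) := by
          congr 1; linear_combination -h3
        linarith
  · intro n
    have h1 : M * W = 1 - PowerSeries.X * PowerSeries.mk (geomMass K p) := by
      rw [hM, mul_assoc, hU, mul_one]
    have h2 := congrArg (PowerSeries.coeff (n + 1)) h1
    rw [hW, mul_sub, mul_one, mul_left_comm, map_sub, map_sub, PowerSeries.coeff_succ_X_mul,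
      PowerSeries.coeff_succ_X_mul, PowerSeries.coeff_mul n M, PowerSeries.coeff_one,
      if_neg (by omega)] at h2
    simp only [PowerSeries.coeff_mk] at h2 ⊢
    linarith

/-- A walk that has not stopped in `{0, …, n}` jumps from its last site `x.1` in `{0, …, n}` over
`n`; summing over that site gives the tail of the stopped walk. -/
theorem sum_mul_tailSeq_eq_geomTail {v m : ℕ → ℝ} {K : ℕ} {p : ℝ} (h0 : m 0 = 1)
    (hm : ∀ n, ∑ x ∈ Finset.HasAntidiagonal.antidiagonal n, m x.1 * v x.2 =
      m (n + 1) + geomMass K p n) (n : ℕ) :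
    ∑ x ∈ Finset.HasAntidiagonal.antidiagonal n, m x.1 * tailSeq v x.2 = geomTail K p n := by
  induction n with
  | zero => simp [h0, tailSeq_zero, geomTail]
  | succ n ih =>
    rw [Finset.Nat.sum_antidiagonal_succ', tailSeq_zero, mul_one]
    simp only [tailSeq_succ, mul_sub, Finset.sum_sub_distrib]
    rw [ih, hm, geomTail_succ]; ring

/-! ### Coarse renewals and gaps of the fine process -/

/-- The value of the i.i.d. process at a site: a coin, and for every age `α` a backward step, which
is a number of sites in `{0, …, α}` to be skipped. -/
abbrev SiteValue : Type := Bool × ((α : ℕ) → Fin (α + 1))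

/-- Coarse renewals occur where the coin shows `true`, but only if at least `K` sites have passed
since the previous coarse renewal. The age `α` is the number of sites since then. -/
def IsCoarse (K α : ℕ) (a : SiteValue) : Prop := a.1 = true ∧ K ≤ α

instance (K α : ℕ) (a : SiteValue) : Decidable (IsCoarse K α a) :=
  inferInstanceAs (Decidable (_ ∧ _))

/-- The age of the site after one of age `α` and value `a`. -/
def nextAge (K α : ℕ) (a : SiteValue) : ℕ := if IsCoarse K α a then 0 else α + 1

/-- The number of zeros of the fine process immediately before a site of age `α`, in terms of the
number `d` of zeros immediately before the next site: the site carries a one if `d = 0`, and then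
its backward step gives the number of zeros. -/
def gapBefore (a : SiteValue) (α d : ℕ) : ℕ := if d = 0 then (a.2 α : ℕ) else d - 1

/-- The number of zeros of the fine process immediately before the first site of `y`, which has age
`α`, computed backwards from the first coarse renewal, which is searched among `M` sites. -/
def gapUpTo (K : ℕ) : ℕ → ℕ → (ℕ → SiteValue) → ℕ
  | 0, _, _ => 0
  | M + 1, α, y => gapBefore (y 0) α
      (if IsCoarse K α (y 0) then 0 else gapUpTo K M (α + 1) fun i => y (i + 1))

/-- A coarse renewal occurs among the first `M` sites of `y`, if the first site has age `α`. -/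
def CoarseWithin (K : ℕ) : ℕ → ℕ → (ℕ → SiteValue) → Prop
  | 0, _, _ => False
  | M + 1, α, y => IsCoarse K α (y 0) ∨ CoarseWithin K M (α + 1) fun i => y (i + 1)

/-- A number of sites that contain a coarse renewal, whatever the age of the first site: they contain
a head of the coin at which the age, unless it has been reset, is at least `K`. It takes the junk
value `0` if there is no such number. -/
noncomputable def horizon (K : ℕ) (y : ℕ → SiteValue) : ℕ :=
  sInf {M | ∃ i < M, K ≤ i ∧ (y i).1 = true}

/-- The number of zeros of the fine process immediately before the first site of `y`, of age `α`. -/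
noncomputable def gap (K α : ℕ) (y : ℕ → SiteValue) : ℕ := gapUpTo K (horizon K y) α y

/-- The coin shows `true` infinitely often. -/
def Frequent (y : ℕ → SiteValue) : Prop := ∀ N, ∃ i, N ≤ i ∧ (y i).1 = true

theorem Frequent.tail {y : ℕ → SiteValue} (hy : Frequent y) : Frequent fun i => y (i + 1) := by
  intro N
  obtain ⟨i, hi, h⟩ := hy (N + 1)
  obtain ⟨i, rfl⟩ : ∃ k, i = k + 1 := ⟨i - 1, by omega⟩
  exact ⟨i, by omega, h⟩

theorem gapBefore_le {a : SiteValue} {α d : ℕ} (h : d ≤ α + 1) : gapBefore a α d ≤ α := by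
  unfold gapBefore
  split_ifs
  · exact Nat.lt_succ_iff.1 (a.2 α).2
  · omega

theorem gapUpTo_le (K M α : ℕ) (y : ℕ → SiteValue) : gapUpTo K M α y ≤ α := by
  induction M generalizing α y with
  | zero => exact Nat.zero_le _
  | succ M ih =>
    refine gapBefore_le ?_
    split_ifs
    · exact Nat.zero_le _
    · exact ih _ _

theorem gap_le (K α : ℕ) (y : ℕ → SiteValue) : gap K α y ≤ α := gapUpTo_le _ _ _ _

/-- The search for a coarse renewal may go further than necessary, and only the sites up to the
coarse renewal matter. -/
theorem CoarseWithin.gapUpTo_eq {K M α : ℕ} {y y' : ℕ → SiteValue} (h : CoarseWithin K M α y)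
    {M' : ℕ} (hM : M ≤ M') (hy : ∀ i < M, y i = y' i) : gapUpTo K M' α y' = gapUpTo K M α y := by
  induction M generalizing α y y' M' with
  | zero => exact h.elim
  | succ M ih =>
    obtain ⟨M', rfl⟩ : ∃ N, M' = N + 1 := ⟨M' - 1, by omega⟩
    simp only [gapUpTo, ← hy 0 (by omega)]
    split_ifs with hc
    · rfl
    · rw [ih (h.resolve_left hc) (by omega) fun i hi => hy (i + 1) (by omega)]

theorem coarseWithin_of_coin {K i α M : ℕ} {y : ℕ → SiteValue} (hi : (y i).1 = true)
    (hK : K ≤ α + i) (hM : i < M) : CoarseWithin K M α y := by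
  induction i generalizing α M y with
  | zero =>
    obtain ⟨M, rfl⟩ : ∃ N, M = N + 1 := ⟨M - 1, by omega⟩
    exact Or.inl ⟨hi, hK⟩
  | succ i ih =>
    obtain ⟨M, rfl⟩ : ∃ N, M = N + 1 := ⟨M - 1, by omega⟩
    exact Or.inr (ih (y := fun i => y (i + 1)) hi (by omega) (by omega))

theorem horizon_spec {K : ℕ} {y : ℕ → SiteValue} {i : ℕ} (hi : (y i).1 = true) (hK : K ≤ i)
    (α : ℕ) : horizon K y ≤ i + 1 ∧ CoarseWithin K (horizon K y) α y := by
  have hmem : i + 1 ∈ {M | ∃ i < M, K ≤ i ∧ (y i).1 = true} := ⟨i, by omega, hK, hi⟩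
  refine ⟨Nat.sInf_le hmem, ?_⟩
  obtain ⟨j, hj, hKj, hyj⟩ := Nat.sInf_mem ⟨_, hmem⟩
  exact coarseWithin_of_coin hyj (by omega) hj

theorem gap_eq_of_coarseWithin {K α M i : ℕ} {y : ℕ → SiteValue} (hi : (y i).1 = true)
    (hK : K ≤ i) (hM : CoarseWithin K M α y) : gap K α y = gapUpTo K M α y := by
  rcases le_total M (horizon K y) with h | h
  · exact hM.gapUpTo_eq h fun _ _ => rfl
  · exact ((horizon_spec hi hK α).2.gapUpTo_eq h fun _ _ => rfl).symm

/-- The gap depends only on the sites up to the first head of the coin after time `K`. -/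
theorem gap_congr {K α i : ℕ} {y y' : ℕ → SiteValue} (hi : (y i).1 = true) (hK : K ≤ i)
    (h : ∀ j ≤ i, y j = y' j) : gap K α y = gap K α y' := by
  have hc := coarseWithin_of_coin (K := K) (α := α) (M := i + 1) hi (by omega) (by omega)
  have hi' : (y' i).1 = true := h i le_rfl ▸ hi
  have hc' := coarseWithin_of_coin (K := K) (α := α) (M := i + 1) hi' (by omega) (by omega)
  rw [gap_eq_of_coarseWithin hi hK hc, gap_eq_of_coarseWithin hi' hK hc']
  exact hc'.gapUpTo_eq le_rfl fun j hj => (h j (by omega)).symm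

/-- The recursion for the gap. At a coarse renewal the next site has age `0`, hence gap `0`, in
accordance with the boundary condition in `gapUpTo`. -/
theorem gap_eq {K α : ℕ} {y : ℕ → SiteValue} (hy : Frequent y) :
    gap K α y = gapBefore (y 0) α (gap K (nextAge K α (y 0)) fun i => y (i + 1)) := by
  obtain ⟨i, hi, hyi⟩ := hy.tail K
  have h1 : gap K α y = gapUpTo K (i + 1 + 1) α y :=
    gap_eq_of_coarseWithin (i := i + 1) hyi (by omega)
      (coarseWithin_of_coin (i := i + 1) hyi (by omega) (by omega))
  rw [h1, gapUpTo, nextAge]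
  split_ifs with hc
  · rw [Nat.le_zero.1 (gap_le K 0 _)]
  · rw [gap_eq_of_coarseWithin (α := α + 1) (M := i + 1) (y := fun i => y (i + 1)) hyi hi
      (coarseWithin_of_coin (y := fun i => y (i + 1)) hyi (by omega) (by omega))]

/-- The age after the last site of a past `z`, listed backwards, if a coarse renewal took place at
the `j`-th last site. -/
def ageFrom (K : ℕ) : ℕ → (ℕ → SiteValue) → ℕ
  | 0, _ => 0
  | j + 1, z => nextAge K (ageFrom K j fun i => z (i + 1)) (z 0)

/-- A head of the coin preceded by `K` tails; a coarse renewal takes place there, whatever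
happened before. -/
def IsMarker (K : ℕ) (z : ℕ → SiteValue) (j : ℕ) : Prop :=
  (z j).1 = true ∧ ∀ i < K, (z (j + 1 + i)).1 = false

/-- The age after the last site of a past `z`, listed backwards, computed from its last marker. If
there is no marker, the value is junk. -/
noncomputable def age (K : ℕ) (z : ℕ → SiteValue) : ℕ := ageFrom K (sInf {j | IsMarker K z j}) z

theorem ageFrom_ge {K j i : ℕ} {z : ℕ → SiteValue} (hij : i ≤ j)
    (h : ∀ k < i, (z k).1 = false) : i ≤ ageFrom K j z := by
  induction i generalizing j z with
  | zero => exact Nat.zero_le _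
  | succ i ih =>
    obtain ⟨j, rfl⟩ : ∃ N, j = N + 1 := ⟨j - 1, by omega⟩
    have h1 := ih (j := j) (z := fun i => z (i + 1)) (by omega) fun k hk => h (k + 1) (by omega)
    rw [ageFrom, nextAge, if_neg]
    · omega
    · intro hc
      have := hc.1
      rw [h 0 (by omega)] at this
      exact absurd this (by decide)

/-- A coarse renewal takes place at a marker, from wherever the computation of the age starts. -/
theorem ageFrom_eq_of_isMarker {K j j' : ℕ} {z : ℕ → SiteValue} (hj : IsMarker K z j)
    (hj' : IsMarker K z j') (hlt : j < j') : ageFrom K j' z = ageFrom K j z := by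
  induction j generalizing j' z with
  | zero =>
    obtain ⟨j', rfl⟩ : ∃ N, j' = N + 1 := ⟨j' - 1, by omega⟩
    have hK : K ≤ j' := by
      by_contra hlt
      have := hj.2 j' (by omega)
      rw [show 0 + 1 + j' = j' + 1 by omega, hj'.1] at this
      exact absurd this (by decide)
    have h1 : K ≤ ageFrom K j' fun i => z (i + 1) :=
      ageFrom_ge hK fun k hk => by have := hj.2 k hk; rwa [show 0 + 1 + k = k + 1 by omega] at this
    rw [ageFrom, ageFrom, nextAge, if_pos ⟨hj.1, h1⟩]
  | succ j ih =>
    obtain ⟨j', rfl⟩ : ∃ N, j' = N + 1 := ⟨j' - 1, by omega⟩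
    have shift : ∀ {k}, IsMarker K z (k + 1) → IsMarker K (fun i => z (i + 1)) k :=
      fun {k} h => ⟨h.1, fun i hi => by
        have := h.2 i hi
        rwa [show k + 1 + 1 + i = k + 1 + i + 1 by omega] at this⟩
    rw [ageFrom, ageFrom, ih (shift hj) (shift hj') (by omega)]

theorem age_eq_ageFrom {K j : ℕ} {z : ℕ → SiteValue} (hj : IsMarker K z j) :
    age K z = ageFrom K j z := by
  have hmem : sInf {j | IsMarker K z j} ∈ {j | IsMarker K z j} := Nat.sInf_mem ⟨j, hj⟩
  rcases (Nat.sInf_le (s := {j | IsMarker K z j}) hj).lt_or_eq with h | h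
  · exact (ageFrom_eq_of_isMarker hmem hj h).symm
  · rw [age, h]

theorem age_eq {K j : ℕ} {z : ℕ → SiteValue} (hj : IsMarker K (fun i => z (i + 1)) j) :
    age K z = nextAge K (age K fun i => z (i + 1)) (z 0) := by
  have : IsMarker K z (j + 1) := ⟨hj.1, fun i hi => by
    have : (z (j + 1 + i + 1)).1 = false := hj.2 i hi
    rwa [show j + 1 + i + 1 = j + 1 + 1 + i by omega] at this⟩
  rw [age_eq_ageFrom this, age_eq_ageFrom hj, ageFrom]

theorem ageFrom_congr {K j : ℕ} {z z' : ℕ → SiteValue} (h : ∀ i < j, z i = z' i) :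
    ageFrom K j z = ageFrom K j z' := by
  induction j generalizing z z' with
  | zero => rfl
  | succ j ih =>
    rw [ageFrom, ageFrom, ih fun i hi => h (i + 1) (by omega), h 0 (by omega)]

/-- The age depends only on the sites down to a marker and the tails that precede it. -/
theorem age_congr {K j : ℕ} {z z' : ℕ → SiteValue} (hj : IsMarker K z j)
    (h : ∀ i ≤ j + K, z i = z' i) : age K z = age K z' := by
  have hj' : IsMarker K z' j := ⟨h j (by omega) ▸ hj.1, fun i hi => h (j + 1 + i) (by omega) ▸ hj.2 i hi⟩
  rw [age_eq_ageFrom hj, age_eq_ageFrom hj', ageFrom_congr fun i hi => h i (by omega)]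

theorem measurableSet_isCoarse (K α : ℕ) : MeasurableSet {a : SiteValue | IsCoarse K α a} :=
  MeasurableSet.inter (measurable_fst (measurableSet_singleton true)) (MeasurableSet.const _)

theorem measurable_nextAge (K : ℕ) : Measurable fun x : ℕ × SiteValue => nextAge K x.1 x.2 := by
  refine measurable_from_prod_countable_right fun α => ?_
  exact Measurable.ite (measurableSet_isCoarse K α) measurable_const
    (measurable_const (a := α + 1))

theorem measurable_gapBefore (α : ℕ) :
    Measurable fun x : ℕ × SiteValue => gapBefore x.2 α x.1 := by
  refine measurable_from_prod_countable_right fun d => ?_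
  change Measurable fun a : SiteValue => if d = 0 then (a.2 α : ℕ) else d - 1
  split_ifs
  · exact (measurable_of_countable _).comp ((measurable_pi_apply α).comp measurable_snd)
  · exact measurable_const

theorem measurable_gapUpTo (K M α : ℕ) : Measurable (gapUpTo K M α) := by
  induction M generalizing α with
  | zero => exact measurable_const
  | succ M ih =>
    refine (measurable_gapBefore α).comp (Measurable.prodMk ?_ (measurable_pi_apply 0))
    refine Measurable.ite ((measurable_pi_apply (X := fun _ : ℕ => SiteValue) 0)
      (measurableSet_isCoarse K α)) measurable_const ?_
    exact (ih (α + 1)).comp (by fun_prop)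

theorem measurable_sInf_nat {β : Type*} [MeasurableSpace β] {S : β → Set ℕ}
    (hS : ∀ n, MeasurableSet {x | n ∈ S x}) : Measurable fun x => sInf (S x) := by
  refine measurable_of_Iic fun n => ?_
  have : (fun x => sInf (S x)) ⁻¹' Set.Iic n =
      (⋃ k ∈ Set.Iic n, {x | k ∈ S x}) ∪ ⋂ k, {x | k ∈ S x}ᶜ := by
    ext x
    simp only [Set.mem_preimage, Set.mem_Iic, Set.mem_union, Set.mem_iUnion, Set.mem_iInter,
      Set.mem_compl_iff]
    constructor
    · intro h
      by_cases hne : (S x).Nonempty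
      · exact Or.inl ⟨_, h, Nat.sInf_mem hne⟩
      · exact Or.inr fun k hk => hne ⟨k, hk⟩
    · rintro (⟨k, hk, h⟩ | h)
      · exact (Nat.sInf_le h).trans hk
      · have : S x = ∅ := Set.eq_empty_of_forall_notMem h
        simp [this]
  rw [this]
  exact (MeasurableSet.biUnion (Set.to_countable _) fun k _ => hS k).union
    (MeasurableSet.iInter fun k => (hS k).compl)

theorem measurableSet_coin (i : ℕ) (b : Bool) : MeasurableSet {y : ℕ → SiteValue | (y i).1 = b} :=
  (measurable_fst.comp (measurable_pi_apply i)) (measurableSet_singleton b)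

theorem measurable_gap (K : ℕ) : Measurable fun x : ℕ × (ℕ → SiteValue) => gap K x.1 x.2 := by
  refine measurable_from_prod_countable_right fun α => ?_
  have h1 : Measurable (horizon K) := measurable_sInf_nat fun M => by
    have : {y : ℕ → SiteValue | ∃ i < M, K ≤ i ∧ (y i).1 = true} =
        ⋃ i ∈ {i | i < M ∧ K ≤ i}, {y : ℕ → SiteValue | (y i).1 = true} := by
      ext y; simp [and_assoc]
    exact this ▸ MeasurableSet.biUnion (Set.to_countable _) fun i _ => measurableSet_coin i true
  have h2 : Measurable fun x : ℕ × (ℕ → SiteValue) => gapUpTo K x.1 α x.2 :=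
    measurable_from_prod_countable_right fun M => measurable_gapUpTo K M α
  exact h2.comp (h1.prodMk measurable_id)

theorem measurableSet_isMarker (K j : ℕ) : MeasurableSet {z | IsMarker K z j} := by
  refine (measurableSet_coin j true).inter ?_
  have : {z : ℕ → SiteValue | ∀ i < K, (z (j + 1 + i)).1 = false} =
      ⋂ i ∈ {i | i < K}, {z : ℕ → SiteValue | (z (j + 1 + i)).1 = false} := by
    ext z; simp
  have h := MeasurableSet.biInter (Set.to_countable {i | i < K})
    fun i _ => measurableSet_coin (j + 1 + i) false
  rw [← this] at h
  exact h

theorem measurable_age (K : ℕ) : Measurable (age K) := by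
  have h1 : Measurable fun z : ℕ → SiteValue => sInf {j | IsMarker K z j} :=
    measurable_sInf_nat fun j => measurableSet_isMarker K j
  have h2 : ∀ j, Measurable (ageFrom K j) := by
    intro j
    induction j with
    | zero => exact measurable_const
    | succ j ih =>
      exact (measurable_nextAge K).comp
        ((ih.comp (by fun_prop)).prodMk (measurable_pi_apply 0))
  have h3 : Measurable fun x : ℕ × (ℕ → SiteValue) => ageFrom K x.1 x.2 :=
    measurable_from_prod_countable_right h2
  exact h3.comp (h1.prodMk measurable_id)

/-! ### Independence and the law of the value at a site -/

section IID

variable {A ι ι' κ : Type*} [MeasurableSpace A] (ρ : Measure A) [IsProbabilityMeasure ρ]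

/-- Two families of coordinates of an i.i.d. family, with no coordinate in common, are independent
i.i.d. families. -/
theorem map_infinitePi_prodMk {f : ι → κ} {g : ι' → κ} (hfg : Function.Injective (Sum.elim f g)) :
    (Measure.infinitePi fun _ : κ => ρ).map (fun ω => (fun i => ω (f i), fun i => ω (g i))) =
      (Measure.infinitePi fun _ : ι => ρ).prod (Measure.infinitePi fun _ : ι' => ρ) := by
  have hm : Measurable fun x : (ι → A) × (ι' → A) => Sum.elim x.1 x.2 := by
    refine measurable_pi_lambda _ fun i => ?_
    cases i <;> simp <;> fun_prop
  have h1 : ((Measure.infinitePi fun _ : ι => ρ).prod (Measure.infinitePi fun _ : ι' => ρ)).map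
      (fun x => Sum.elim x.1 x.2) = Measure.infinitePi fun _ : ι ⊕ ι' => ρ := by
    refine Measure.eq_infinitePi _ fun s t ht => ?_
    rw [Measure.map_apply hm (MeasurableSet.pi s.countable_toSet fun i _ => ht i)]
    have : (fun x : (ι → A) × (ι' → A) => Sum.elim x.1 x.2) ⁻¹' Set.pi s t =
        (Set.pi s.toLeft fun i => t (.inl i)) ×ˢ (Set.pi s.toRight fun i => t (.inr i)) := by
      ext x
      simp [Set.mem_pi]
    rw [this, Measure.prod_prod, Measure.infinitePi_pi _ fun i _ => ht _,
      Measure.infinitePi_pi _ fun i _ => ht _]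
    conv_rhs => rw [← s.toLeft_disjSum_toRight, Finset.prod_disjSum]
  have h2 := Measure.map_infinitePi_infinitePi_of_inj (P := fun _ : κ => ρ) hfg
  rw [← h1] at h2
  have h3 := congrArg (Measure.map fun z : ι ⊕ ι' → A => (fun i => z (.inl i), fun i => z (.inr i))) h2
  rw [Measure.map_map (by fun_prop) hm, Measure.map_map (by fun_prop) (by fun_prop)] at h3
  refine Eq.trans h3 ?_
  exact Measure.map_id

theorem infinitePi_real_cons {B : Set A} {T : Set (ℕ → A)} (hB : MeasurableSet B)
    (hT : MeasurableSet T) :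
    (Measure.infinitePi fun _ : ℕ => ρ).real {y | y 0 ∈ B ∧ (fun i => y (i + 1)) ∈ T} =
      ρ.real B * (Measure.infinitePi fun _ : ℕ => ρ).real T := by
  have h := map_infinitePi_prodMk ρ (f := fun _ : Unit => (0 : ℕ)) (g := fun i : ℕ => i + 1) (by
    rintro (⟨⟩ | i) (⟨⟩ | j) <;> simp)
  have h2 := congrArg (fun μ => μ (((fun z : Unit → A => z ()) ⁻¹' B) ×ˢ T)) h
  have hB' : MeasurableSet ((fun z : Unit → A => z ()) ⁻¹' B) := measurable_pi_apply () hB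
  have h3 : (Measure.infinitePi fun _ : Unit => ρ) ((fun z : Unit → A => z ()) ⁻¹' B) = ρ B := by
    rw [← Measure.map_apply (measurable_pi_apply ()) hB, Measure.infinitePi_map_eval]
  simp only at h2
  rw [Measure.map_apply (by fun_prop) (hB'.prod hT), Measure.prod_prod, h3] at h2
  rw [measureReal_def, measureReal_def, measureReal_def, ← ENNReal.toReal_mul, ← h2]
  rfl

/-- In an i.i.d. sequence an event of positive probability occurs. -/
theorem ae_exists_mem_of_iid {B : Set A} (hB : MeasurableSet B) (h : ρ B ≠ 0) :
    ∀ᵐ y ∂(Measure.infinitePi fun _ : ℕ => ρ), ∃ i, y i ∈ B := by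
  set T : Set (ℕ → A) := {y | ∀ i, y i ∉ B} with hTdef
  have hT : MeasurableSet T := by
    have : T = ⋂ i, {y : ℕ → A | y i ∈ Bᶜ} := by ext y; simp [hTdef]
    rw [this]
    exact MeasurableSet.iInter fun i => measurable_pi_apply i hB.compl
  have h1 := infinitePi_real_cons ρ hB.compl hT
  have h2 : {y : ℕ → A | y 0 ∈ Bᶜ ∧ (fun i => y (i + 1)) ∈ T} = T := by
    ext y
    refine ⟨fun hy i => ?_, fun hy => ⟨hy 0, fun i => hy (i + 1)⟩⟩
    cases i with
    | zero => exact hy.1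
    | succ i => exact hy.2 i
  rw [h2, probReal_compl_eq_one_sub hB] at h1
  have h3 : 0 < ρ.real B := ENNReal.toReal_pos h (measure_ne_top _ _)
  have h4 : (Measure.infinitePi fun _ : ℕ => ρ).real T = 0 := by nlinarith
  rw [measureReal_eq_zero_iff] at h4
  filter_upwards [measure_eq_zero_iff_ae_notMem.1 h4] with y hy
  simpa [hTdef] using hy

end IID

theorem exists_measure_of_sum_eq_one {β : Type*} [Fintype β] [MeasurableSpace β]
    [MeasurableSingletonClass β] {f : β → ℝ} (hf : ∀ b, 0 ≤ f b) (hs : ∑ b, f b = 1) :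
    ∃ μ : Measure β, IsProbabilityMeasure μ ∧ ∀ b, μ.real {b} = f b := by
  refine ⟨(PMF.ofFintype (fun b => ENNReal.ofReal (f b)) ?_).toMeasure, inferInstance, fun b => ?_⟩
  · rw [← ENNReal.ofReal_sum_of_nonneg fun b _ => hf b, hs, ENNReal.ofReal_one]
  · rw [measureReal_def, PMF.toMeasure_apply_singleton _ _ (measurableSet_singleton b),
      PMF.ofFintype_apply, ENNReal.toReal_ofReal (hf b)]

/-- The law of the value at a site, given the expected numbers of visits `m` of the stopped walk:
a coin with success probability `p`, and, for every age `n`, the last step of the stopped walk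
given that it has arrived at `n + 1`. If it cannot arrive there, the step is arbitrary. -/
theorem exists_siteLaw {v m : ℕ → ℝ} {K : ℕ} {p : ℝ} (hv : ∀ n, 0 ≤ v n) (hp0 : 0 < p)
    (hp1 : p < 1) (hm0 : ∀ n, 0 ≤ m n)
    (hm : ∀ n, ∑ x ∈ Finset.HasAntidiagonal.antidiagonal n, m x.1 * v x.2 =
      m (n + 1) + geomMass K p n) :
    ∃ (ρ : Measure SiteValue) (k : ℕ → ℕ → ℝ), IsProbabilityMeasure ρ ∧
      (∀ b, ρ.real {a | a.1 = b} = if b then p else 1 - p) ∧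
      (∀ b n c, ρ.real {a | a.1 = b ∧ (a.2 n : ℕ) = c} = (if b then p else 1 - p) * k n c) ∧
      (∀ n c, 0 ≤ k n c) ∧ (∀ n, ∑ c ∈ Finset.range (n + 1), k n c ≤ 1) ∧
      ∀ n c, c ≤ n → k n c * (m (n + 1) + geomMass K p n) = m (n - c) * v c := by
  have hm' : ∀ n, ∑ c : Fin (n + 1), m (n - c) * v c = m (n + 1) + geomMass K p n := by
    intro n
    rw [← hm, ← Finset.Nat.sum_antidiagonal_swap, Finset.Nat.sum_antidiagonal_eq_sum_range_succ_mk]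
    exact Fin.sum_univ_eq_sum_range (fun c => m (n - c) * v c) (n + 1)
  have hstep : ∀ n, ∃ μ : Measure (Fin (n + 1)), IsProbabilityMeasure μ ∧
      ∀ c, μ.real {c} * (m (n + 1) + geomMass K p n) = m (n - c) * v c := by
    intro n
    rcases eq_or_ne (m (n + 1) + geomMass K p n) 0 with h0 | h0
    · refine ⟨Measure.dirac 0, inferInstance, fun c => ?_⟩
      rw [h0, mul_zero]
      have := hm' n
      rw [h0, Finset.sum_eq_zero_iff_of_nonneg fun c _ => mul_nonneg (hm0 _) (hv _)] at this
      exact (this c (Finset.mem_univ c)).symm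
    · obtain ⟨μ, hμ, h⟩ := exists_measure_of_sum_eq_one
        (f := fun c : Fin (n + 1) => m (n - c) * v c / (m (n + 1) + geomMass K p n))
        (fun c => div_nonneg (mul_nonneg (hm0 _) (hv _))
          (hm' n ▸ Finset.sum_nonneg fun c _ => mul_nonneg (hm0 _) (hv _)))
        (by rw [← Finset.sum_div, hm', div_self h0])
      exact ⟨μ, hμ, fun c => by rw [h, div_mul_cancel₀ _ h0]⟩
  choose μ hμ hμc using hstep
  obtain ⟨β, hβ, hβb⟩ := exists_measure_of_sum_eq_one (f := fun b : Bool => if b then p else 1 - p)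
    (by intro b; cases b <;> simp <;> linarith) (by simp)
  have hprod : ∀ (B : Set Bool) (n : ℕ) (c : Set ℕ),
      (β.prod (Measure.infinitePi μ)).real {a | a.1 ∈ B ∧ (a.2 n : ℕ) ∈ c} =
      β.real B * (μ n).real {i | (i : ℕ) ∈ c} := by
    intro B n c
    have : {a : SiteValue | a.1 ∈ B ∧ (a.2 n : ℕ) ∈ c} =
        B ×ˢ ((fun x : (j : ℕ) → Fin (j + 1) => x n) ⁻¹' {i | (i : ℕ) ∈ c}) := by
      ext; simp
    rw [this, measureReal_prod_prod]
    congr 1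
    rw [← map_measureReal_apply (measurable_pi_apply n) (Set.to_countable _).measurableSet,
      Measure.infinitePi_map_eval]
  refine ⟨β.prod (Measure.infinitePi μ), fun n c => (μ n).real {i | (i : ℕ) = c}, inferInstance,
    fun b => ?_, fun b n c => ?_, fun n c => measureReal_nonneg, fun n => ?_, fun n c hc => ?_⟩
  · have := hprod {b} 0 Set.univ
    simpa [hβb] using this
  · have := hprod {b} n {c}
    simpa [hβb] using this
  · rw [← Fin.sum_univ_eq_sum_range (fun c => (μ n).real {i | (i : ℕ) = c})]
    have : ∀ c : Fin (n + 1), {i : Fin (n + 1) | (i : ℕ) = c} = {c} := fun c => by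
      ext i; simp [Fin.ext_iff]
    simp only [this]
    rw [sum_measureReal_singleton]
    exact measureReal_le_one
  · have : {i : Fin (n + 1) | (i : ℕ) = c} = {⟨c, by omega⟩} := by
      ext i; simp [Fin.ext_iff]
    simp only [this]
    exact hμc n ⟨c, by omega⟩

/-! ### The law of the future, given the age -/

/-- The sequence `m` consists of the expected numbers of visits, before stopping, of a random walk that
is stopped with law `1 + K + geometric`, and whose increment is `n + 1` with probability `v n`. The
measure `ρ` is a corresponding law of the value at a site: a coin with success probability `p`,
and, independently, for every age `n` a backward step with law `k n`, which is the law of the last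
step of a stopped walk that has arrived at `n + 1`. -/
structure IsSiteLaw (v m : ℕ → ℝ) (K : ℕ) (p : ℝ) (ρ : Measure SiteValue) (k : ℕ → ℕ → ℝ) :
    Prop where
  v_nonneg : ∀ n, 0 ≤ v n
  hasSum : HasSum v 1
  p_pos : 0 < p
  p_lt_one : p < 1
  m_zero : m 0 = 1
  m_nonneg : ∀ n, 0 ≤ m n
  conv : ∀ n, ∑ x ∈ Finset.HasAntidiagonal.antidiagonal n, m x.1 * v x.2 =
    m (n + 1) + geomMass K p n
  prob : IsProbabilityMeasure ρ
  coin : ∀ b, ρ.real {a | a.1 = b} = if b then p else 1 - p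
  coin_step : ∀ b n c, ρ.real {a | a.1 = b ∧ (a.2 n : ℕ) = c} = (if b then p else 1 - p) * k n c
  k_nonneg : ∀ n c, 0 ≤ k n c
  k_sum : ∀ n, ∑ c ∈ Finset.range (n + 1), k n c ≤ 1
  k_mul : ∀ n c, c ≤ n → k n c * (m (n + 1) + geomMass K p n) = m (n - c) * v c

/-- The sequences `y` of future sites such that, if the first site has age `α`, there are exactly
`c` zeros of the fine process immediately before it, and from it on the fine process starts with
the word `σ`. -/
def wordSet (K : ℕ) : List Bool → ℕ → ℕ → Set (ℕ → SiteValue)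
  | [], c, α => {y | gap K α y = c}
  | false :: σ, c, α =>
      {y | ¬ IsCoarse K α (y 0) ∧ (fun i => y (i + 1)) ∈ wordSet K σ (c + 1) (α + 1)}
  | true :: σ, c, α =>
      {y | ((y 0).2 α : ℕ) = c ∧ (fun i => y (i + 1)) ∈ wordSet K σ 0 (nextAge K α (y 0))}

/-- The probability that the values after a one start with `c` zeros and the word `σ`, in a renewal
process whose jump is `n + 1` with probability `v n`. -/
def wordWeight (v : ℕ → ℝ) : List Bool → ℕ → ℝ
  | [], c => tailSeq v c
  | false :: σ, c => wordWeight v σ (c + 1)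
  | true :: σ, c => v c * wordWeight v σ 0

theorem measurableSet_wordSet (K : ℕ) (σ : List Bool) (c α : ℕ) :
    MeasurableSet (wordSet K σ c α) := by
  have htail : Measurable fun (y : ℕ → SiteValue) i => y (i + 1) := by fun_prop
  have h0 : Measurable fun y : ℕ → SiteValue => y 0 := measurable_pi_apply 0
  induction σ generalizing c α with
  | nil => exact ((measurable_gap K).comp measurable_prodMk_left) (measurableSet_singleton c)
  | cons b σ ih =>
    cases b with
    | false => exact (h0 (measurableSet_isCoarse K α).compl).inter (htail (ih (c + 1) (α + 1)))
    | true =>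
      have h1 : Measurable fun y : ℕ → SiteValue => ((y 0).2 α : ℕ) :=
        (measurable_of_countable _).comp ((measurable_pi_apply α).comp (measurable_snd.comp h0))
      have h2 : {y : ℕ → SiteValue | (fun i => y (i + 1)) ∈ wordSet K σ 0 (nextAge K α (y 0))} =
          ⋃ β, {y | nextAge K α (y 0) = β} ∩ {y | (fun i => y (i + 1)) ∈ wordSet K σ 0 β} := by
        ext y; simp
      have h3 : MeasurableSet
          {y : ℕ → SiteValue | (fun i => y (i + 1)) ∈ wordSet K σ 0 (nextAge K α (y 0))} := by
        rw [h2]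
        refine MeasurableSet.iUnion fun β => MeasurableSet.inter ?_ (htail (ih 0 β))
        exact ((measurable_nextAge K).comp (measurable_const.prodMk h0))
          (measurableSet_singleton β)
      exact (h1 (measurableSet_singleton c)).inter h3

/-- The gap is `c` in two cases: the first site carries a zero and the gap before the next site is
`c + 1`, or it carries a one and has the backward step `c`. -/
theorem mem_wordSet_nil {K α c : ℕ} {y : ℕ → SiteValue} (hy : Frequent y) :
    y ∈ wordSet K [] c α ↔
      (¬ IsCoarse K α (y 0) ∧ gap K (α + 1) (fun i => y (i + 1)) = c + 1) ∨
      (((y 0).2 α : ℕ) = c ∧ gap K (nextAge K α (y 0)) (fun i => y (i + 1)) = 0) := by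
  rw [wordSet, Set.mem_ofPred_eq, gap_eq hy, gapBefore]
  split_ifs with h
  · refine ⟨fun h' => Or.inr ⟨h', h⟩, ?_⟩
    rintro (⟨h1, h2⟩ | ⟨h1, -⟩)
    · rw [nextAge, if_neg h1] at h; omega
    · exact h1
  · by_cases hc : IsCoarse K α (y 0)
    · rw [nextAge, if_pos hc] at h
      exact absurd (Nat.le_zero.1 (gap_le _ _ _)) h
    · have h' := h
      rw [nextAge, if_neg hc] at h' ⊢
      simp only [hc, not_false_eq_true, true_and, h', and_false, or_false]
      omega

section Law

variable {v m : ℕ → ℝ} {K : ℕ} {p : ℝ} {ρ : Measure SiteValue} {k : ℕ → ℕ → ℝ}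

theorem ae_frequent (h : IsSiteLaw v m K p ρ k) :
    ∀ᵐ y ∂(Measure.infinitePi fun _ : ℕ => ρ), Frequent y := by
  have := h.prob
  refine ae_all_iff.2 fun N => ?_
  have h1 := ae_exists_mem_of_iid ρ (B := {a | a.1 = true})
    (measurable_fst (measurableSet_singleton true)) fun h0 => by
      have := h.coin true
      rw [measureReal_def, h0] at this
      simp [h.p_pos.ne] at this
  have h2 : MeasurePreserving (fun (y : ℕ → SiteValue) i => y (i + N))
      (Measure.infinitePi fun _ : ℕ => ρ) (Measure.infinitePi fun _ : ℕ => ρ) :=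
    ⟨by fun_prop, Measure.map_infinitePi_infinitePi_of_inj (f := fun i : ℕ => i + N)
      (add_left_injective N)⟩
  filter_upwards [h2.quasiMeasurePreserving.ae h1] with y ⟨i, hi⟩
  exact ⟨i + N, by omega, hi⟩

theorem IsSiteLaw.real_not_isCoarse (h : IsSiteLaw v m K p ρ k) (α : ℕ) :
    ρ.real {a | ¬ IsCoarse K α a} = 1 - if K ≤ α then p else 0 := by
  have := h.prob
  split_ifs with hK
  · have h1 := h.coin false
    have h2 : {a : SiteValue | ¬ IsCoarse K α a} = {a | a.1 = false} := by
      ext a; simp [IsCoarse, hK]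
    rw [h2, h1]; simp
  · have h2 : {a : SiteValue | ¬ IsCoarse K α a} = Set.univ := by
      ext a; simp [IsCoarse, hK]
    rw [h2]; simp

theorem IsSiteLaw.real_step_and_isCoarse (h : IsSiteLaw v m K p ρ k) (α c : ℕ) :
    ρ.real {a | (a.2 α : ℕ) = c ∧ IsCoarse K α a} = k α c * if K ≤ α then p else 0 := by
  split_ifs with hK
  · have h2 : {a : SiteValue | (a.2 α : ℕ) = c ∧ IsCoarse K α a} =
        {a | a.1 = true ∧ (a.2 α : ℕ) = c} := by
      ext a; simp [IsCoarse, hK, and_comm]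
    rw [h2, h.coin_step, if_pos rfl, mul_comm]
  · have h2 : {a : SiteValue | (a.2 α : ℕ) = c ∧ IsCoarse K α a} = ∅ := by
      ext a; simp [IsCoarse, hK]
    rw [h2]; simp

theorem IsSiteLaw.real_step (h : IsSiteLaw v m K p ρ k) (α c : ℕ) :
    ρ.real {a | (a.2 α : ℕ) = c} = k α c := by
  have := h.prob
  have h1 : {a : SiteValue | (a.2 α : ℕ) = c} =
      {a | a.1 = true ∧ (a.2 α : ℕ) = c} ∪ {a | a.1 = false ∧ (a.2 α : ℕ) = c} := by
    ext a; cases ha : a.1 <;> simp [ha]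
  have hstep : MeasurableSet {a : SiteValue | (a.2 α : ℕ) = c} :=
    ((measurable_of_countable _).comp ((measurable_pi_apply α).comp measurable_snd))
      (measurableSet_singleton c)
  rw [h1, measureReal_union, h.coin_step, h.coin_step]
  · simp; ring
  · rw [Set.disjoint_left]; rintro a ⟨h1, -⟩ ⟨h2, -⟩; rw [h1] at h2; exact absurd h2 (by decide)
  · exact (measurable_fst (measurableSet_singleton false)).inter hstep

theorem IsSiteLaw.real_step_and_not_isCoarse (h : IsSiteLaw v m K p ρ k) (α c : ℕ) :
    ρ.real {a | (a.2 α : ℕ) = c ∧ ¬ IsCoarse K α a} = k α c * (1 - if K ≤ α then p else 0) := by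
  have := h.prob
  have h1 : {a : SiteValue | (a.2 α : ℕ) = c ∧ ¬ IsCoarse K α a} =
      {a | (a.2 α : ℕ) = c} \ {a | (a.2 α : ℕ) = c ∧ IsCoarse K α a} := by
    ext a; simp +contextual
  have hstep : MeasurableSet {a : SiteValue | (a.2 α : ℕ) = c} :=
    ((measurable_of_countable _).comp ((measurable_pi_apply α).comp measurable_snd))
      (measurableSet_singleton c)
  have hm : MeasurableSet {a : SiteValue | (a.2 α : ℕ) = c ∧ IsCoarse K α a} :=
    hstep.inter (measurableSet_isCoarse K α)
  have hsub : {a : SiteValue | (a.2 α : ℕ) = c ∧ IsCoarse K α a} ⊆ {a | (a.2 α : ℕ) = c} :=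
    fun a ha => ha.1
  rw [h1, measureReal_sdiff hsub hm,
    h.real_step, h.real_step_and_isCoarse]
  ring

/-- One step of the future: the case of a zero at the first site. -/
theorem IsSiteLaw.real_false (h : IsSiteLaw v m K p ρ k) (α : ℕ) {T : Set (ℕ → SiteValue)}
    (hT : MeasurableSet T) :
    (Measure.infinitePi fun _ : ℕ => ρ).real
      {y | ¬ IsCoarse K α (y 0) ∧ (fun i => y (i + 1)) ∈ T} * geomTail K p α =
    (Measure.infinitePi fun _ : ℕ => ρ).real T * geomTail K p (α + 1) := by
  have := h.prob
  have h1 : (Measure.infinitePi fun _ : ℕ => ρ).real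
      {y | ¬ IsCoarse K α (y 0) ∧ (fun i => y (i + 1)) ∈ T} =
      ρ.real {a | ¬ IsCoarse K α a} * (Measure.infinitePi fun _ : ℕ => ρ).real T :=
    infinitePi_real_cons ρ (measurableSet_isCoarse K α).compl hT
  rw [geomTail_succ_mul, h1, h.real_not_isCoarse]
  ring

/-- One step of the future: the case of a one at the first site. -/
theorem IsSiteLaw.real_true (h : IsSiteLaw v m K p ρ k) (α c : ℕ) {T : ℕ → Set (ℕ → SiteValue)}
    (hT : ∀ β, MeasurableSet (T β)) :
    (Measure.infinitePi fun _ : ℕ => ρ).real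
      {y | ((y 0).2 α : ℕ) = c ∧ (fun i => y (i + 1)) ∈ T (nextAge K α (y 0))} * geomTail K p α =
    k α c * (geomMass K p α * (Measure.infinitePi fun _ : ℕ => ρ).real (T 0) +
      geomTail K p (α + 1) * (Measure.infinitePi fun _ : ℕ => ρ).real (T (α + 1))) := by
  have := h.prob
  set Q := Measure.infinitePi fun _ : ℕ => ρ with hQ
  have hstep : MeasurableSet {a : SiteValue | (a.2 α : ℕ) = c} :=
    ((measurable_of_countable _).comp ((measurable_pi_apply α).comp measurable_snd))
      (measurableSet_singleton c)
  have hB1 : MeasurableSet {a : SiteValue | (a.2 α : ℕ) = c ∧ IsCoarse K α a} :=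
    hstep.inter (measurableSet_isCoarse K α)
  have hB2 : MeasurableSet {a : SiteValue | (a.2 α : ℕ) = c ∧ ¬ IsCoarse K α a} :=
    hstep.inter (measurableSet_isCoarse K α).compl
  have h1 : {y : ℕ → SiteValue | ((y 0).2 α : ℕ) = c ∧
        (fun i => y (i + 1)) ∈ T (nextAge K α (y 0))} =
      {y | y 0 ∈ {a : SiteValue | (a.2 α : ℕ) = c ∧ IsCoarse K α a} ∧
        (fun i => y (i + 1)) ∈ T 0} ∪
      {y | y 0 ∈ {a : SiteValue | (a.2 α : ℕ) = c ∧ ¬ IsCoarse K α a} ∧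
        (fun i => y (i + 1)) ∈ T (α + 1)} := by
    ext y
    by_cases hc : IsCoarse K α (y 0) <;> simp [nextAge, hc]
  have htail : Measurable fun (y : ℕ → SiteValue) i => y (i + 1) := by fun_prop
  rw [h1, measureReal_union, infinitePi_real_cons ρ hB1 (hT 0),
    infinitePi_real_cons ρ hB2 (hT (α + 1)), h.real_step_and_isCoarse,
    h.real_step_and_not_isCoarse, geomTail_succ_mul, geomMass_eq, ← hQ]
  · ring
  · rw [Set.disjoint_left]; rintro a ⟨h1, -⟩ ⟨h2, -⟩; exact h2.2 h1.2
  · exact ((measurable_pi_apply (X := fun _ : ℕ => SiteValue) 0) hB2).inter (htail (hT (α + 1)))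

theorem IsSiteLaw.geomTail_eq (h : IsSiteLaw v m K p ρ k) (α : ℕ) :
    ∑ c ∈ Finset.range (α + 1), m (α - c) * tailSeq v c = geomTail K p α := by
  rw [← sum_mul_tailSeq_eq_geomTail h.m_zero h.conv α, ← Finset.Nat.sum_antidiagonal_swap,
    Finset.Nat.sum_antidiagonal_eq_sum_range_succ_mk]
  rfl

/-- The law of the gap before a site, given its age. Both sides satisfy the same recursion in the
age, and their difference at age `α` is bounded by the difference at age `α + j`, which tends
to `0` since it is at most twice a geometric tail. -/
theorem IsSiteLaw.real_gap (h : IsSiteLaw v m K p ρ k) {α c : ℕ} (hc : c ≤ α) :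
    (Measure.infinitePi fun _ : ℕ => ρ).real {y | gap K α y = c} * geomTail K p α =
      m (α - c) * tailSeq v c := by
  have := h.prob
  set Q := Measure.infinitePi fun _ : ℕ => ρ with hQ
  set G : ℕ → ℕ → ℝ := fun α c => Q.real {y | gap K α y = c} with hG
  have hGmeas : ∀ α c, MeasurableSet {y | gap K α y = c} := fun α c =>
    measurableSet_wordSet K [] c α
  have htail : Measurable fun (y : ℕ → SiteValue) i => y (i + 1) := by fun_prop
  have hG00 : G 0 0 = 1 := by
    have : {y : ℕ → SiteValue | gap K 0 y = 0} = Set.univ :=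
      Set.eq_univ_of_forall fun y => Nat.le_zero.1 (gap_le K 0 y)
    simp [hG, this]
  have hrec : ∀ α c, G α c * geomTail K p α = G (α + 1) (c + 1) * geomTail K p (α + 1) +
      k α c * (geomMass K p α + geomTail K p (α + 1) * G (α + 1) 0) := by
    intro α c
    have h1 := h.real_false α (hGmeas (α + 1) (c + 1))
    have h2 := h.real_true α c (T := fun β => {y | gap K β y = 0}) fun β => hGmeas β 0
    have h3 : G α c = Q.real ({y | ¬ IsCoarse K α (y 0) ∧
        (fun i => y (i + 1)) ∈ {y | gap K (α + 1) y = c + 1}} ∪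
        {y | ((y 0).2 α : ℕ) = c ∧
          (fun i => y (i + 1)) ∈ {z | gap K (nextAge K α (y 0)) z = 0}}) := by
      refine measureReal_congr ?_
      filter_upwards [ae_frequent h] with y hy
      exact propext (mem_wordSet_nil hy)
    rw [measureReal_union₀' ?_ ?_] at h3
    · rw [h3, add_mul, h1, h2]
      change _ + k α c * (geomMass K p α * G 0 0 + _) = _
      rw [hG00, mul_one]
    · refine MeasurableSet.nullMeasurableSet ?_
      exact ((measurable_pi_apply (X := fun _ : ℕ => SiteValue) 0)
        (measurableSet_isCoarse K α).compl).inter (htail (hGmeas (α + 1) (c + 1)))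
    · refine Disjoint.aedisjoint ?_
      rw [Set.disjoint_left]
      rintro y ⟨h1, h2⟩ ⟨-, h3⟩
      rw [nextAge, if_neg h1, Set.mem_ofPred_eq] at h3
      rw [Set.mem_ofPred_eq] at h2
      omega
  set E : ℕ → ℕ → ℝ := fun α c => G α c * geomTail K p α - m (α - c) * tailSeq v c with hE
  have hErec : ∀ α c, c ≤ α → E α c = E (α + 1) (c + 1) + k α c * E (α + 1) 0 := by
    intro α c hc
    have h1 := h.k_mul α c hc
    simp only [hE, hrec α c, tailSeq_succ, tailSeq_zero, Nat.add_sub_add_right, Nat.sub_zero]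
    linear_combination h1
  set N : ℕ → ℝ := fun α => ∑ c ∈ Finset.range (α + 1), |E α c| with hN
  have hNsucc : ∀ α, N α ≤ N (α + 1) := by
    intro α
    calc N α ≤ ∑ c ∈ Finset.range (α + 1), (|E (α + 1) (c + 1)| + k α c * |E (α + 1) 0|) := by
          refine Finset.sum_le_sum fun c hc => ?_
          rw [hErec α c (by have := Finset.mem_range.1 hc; omega)]
          refine (abs_add_le _ _).trans (add_le_add_right (le_of_eq ?_) _)
          rw [abs_mul, abs_of_nonneg (h.k_nonneg α c)]
      _ = ∑ c ∈ Finset.range (α + 1), |E (α + 1) (c + 1)| +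
          (∑ c ∈ Finset.range (α + 1), k α c) * |E (α + 1) 0| := by
          rw [Finset.sum_add_distrib, Finset.sum_mul]
      _ ≤ ∑ c ∈ Finset.range (α + 1), |E (α + 1) (c + 1)| + |E (α + 1) 0| := by
          gcongr
          exact mul_le_of_le_one_left (abs_nonneg _) (h.k_sum α)
      _ = N (α + 1) := (Finset.sum_range_succ' (fun c => |E (α + 1) c|) (α + 1)).symm
  have hNle : ∀ α, N α ≤ 2 * geomTail K p α := by
    intro α
    have hpos := (geomTail_pos (K := K) h.p_lt_one α).le
    have h1 : ∑ c ∈ Finset.range (α + 1), G α c ≤ 1 := by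
      rw [hG]
      simp only
      rw [← measureReal_biUnion_finset ?_ fun c _ => hGmeas α c]
      · exact measureReal_le_one
      · intro c _ c' _ hcc'
        rw [Function.onFun, Set.disjoint_left]
        intro y h1 h2
        exact hcc' (h1.symm.trans h2)
    calc N α ≤ ∑ c ∈ Finset.range (α + 1), (G α c * geomTail K p α + m (α - c) * tailSeq v c) := by
          refine Finset.sum_le_sum fun c _ => (abs_sub _ _).trans (le_of_eq ?_)
          rw [abs_of_nonneg (mul_nonneg measureReal_nonneg hpos),
            abs_of_nonneg (mul_nonneg (h.m_nonneg _) (tailSeq_nonneg h.v_nonneg h.hasSum _))]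
      _ = (∑ c ∈ Finset.range (α + 1), G α c) * geomTail K p α + geomTail K p α := by
          rw [Finset.sum_add_distrib, Finset.sum_mul, h.geomTail_eq]
      _ ≤ 2 * geomTail K p α := by nlinarith
  have hmono : Monotone N := monotone_nat_of_le_succ hNsucc
  have hlim : Filter.Tendsto (fun j : ℕ => 2 * geomTail K p (K + j)) Filter.atTop (nhds 0) := by
    have h1 := tendsto_pow_atTop_nhds_zero_of_lt_one (r := 1 - p)
      (by linarith [h.p_lt_one]) (by linarith [h.p_pos])
    simpa [geomTail] using h1.const_mul 2
  have hN0 : N α ≤ 0 := by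
    refine ge_of_tendsto hlim ?_
    filter_upwards [Filter.eventually_ge_atTop α] with j hj
    exact (hmono (by omega)).trans (hNle _)
  have h1 : |E α c| ≤ N α :=
    Finset.single_le_sum (f := fun c => |E α c|) (fun _ _ => abs_nonneg _)
      (Finset.mem_range.2 (by omega))
  have h2 : E α c = 0 := abs_nonpos_iff.1 (h1.trans hN0)
  exact sub_eq_zero.1 h2

/-- The law of the words of the fine process, given the age. The dependence on the age factors out. -/
theorem IsSiteLaw.real_wordSet (h : IsSiteLaw v m K p ρ k) (σ : List Bool) {α c : ℕ}
    (hc : c ≤ α) :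
    (Measure.infinitePi fun _ : ℕ => ρ).real (wordSet K σ c α) * geomTail K p α =
      m (α - c) * wordWeight v σ c := by
  induction σ generalizing c α with
  | nil => exact h.real_gap hc
  | cons b σ ih =>
    cases b with
    | false =>
      have h1 := h.real_false α (measurableSet_wordSet K σ (c + 1) (α + 1))
      have h2 := ih (α := α + 1) (c := c + 1) (by omega)
      rw [Nat.add_sub_add_right] at h2
      exact h1.trans h2
    | true =>
      have h1 := h.real_true α c fun β => measurableSet_wordSet K σ 0 β
      refine h1.trans ?_
      have h2 := ih (α := 0) (c := 0) le_rfl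
      have h3 := ih (α := α + 1) (c := 0) (Nat.zero_le _)
      have h4 : geomTail K p 0 = 1 := by simp [geomTail]
      rw [h4, mul_one, Nat.sub_zero, h.m_zero, one_mul] at h2
      rw [Nat.sub_zero] at h3
      rw [h2, mul_comm (geomTail K p (α + 1)), h3, wordWeight]
      linear_combination wordWeight v σ 0 * h.k_mul α c hc

end Law

/-! ### The two-sided fine process -/

/-- From the `n`-th site on the process `X` carries the word `σ`; its ones are the places where
the word is `true`. -/
def WordAt {Ω : Type*} (X : ℤ → Ω → Fin 2) : List Bool → ℤ → Ω → Prop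
  | [], _, _ => True
  | b :: σ, n, ω => (X n ω = 1 ↔ b = true) ∧ WordAt X σ (n + 1) ω

/-- The sites from `n` on. -/
def future (n : ℤ) (ω : ℤ → SiteValue) (i : ℕ) : SiteValue := ω (n + i)

/-- The sites before `n`, listed backwards. -/
def past (n : ℤ) (ω : ℤ → SiteValue) (i : ℕ) : SiteValue := ω (n - 1 - i)

/-- The number of zeros of the fine process immediately before the site `n`. -/
noncomputable def gapAt (K : ℕ) (n : ℤ) (ω : ℤ → SiteValue) : ℕ :=
  gap K (age K (past n ω)) (future n ω)

/-- The fine process at the origin. -/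
noncomputable def fineZero (K : ℕ) (ω : ℤ → SiteValue) : Fin 2 := if gapAt K 1 ω = 0 then 1 else 0

/-- The fine process. -/
noncomputable def fine (K : ℕ) (n : ℤ) (ω : ℤ → SiteValue) : Fin 2 :=
  fineZero K fun k => ω (n + k)

/-- Every site has a marker somewhere before it and heads infinitely often after it. -/
def HasMarkers (K : ℕ) (ω : ℤ → SiteValue) : Prop :=
  ∀ n, (∃ j, IsMarker K (past n ω) j) ∧ Frequent (future n ω)

theorem past_succ_tail (n : ℤ) (ω : ℤ → SiteValue) :
    (fun i => past (n + 1) ω (i + 1)) = past n ω := by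
  funext i
  simp only [past]
  congr 1
  push_cast
  ring

theorem future_tail (n : ℤ) (ω : ℤ → SiteValue) :
    (fun i => future n ω (i + 1)) = future (n + 1) ω := by
  funext i
  simp only [future]
  congr 1
  push_cast
  ring

theorem fine_eq_one_iff (K : ℕ) (n : ℤ) (ω : ℤ → SiteValue) :
    fine K n ω = 1 ↔ gapAt K (n + 1) ω = 0 := by
  have h1 : past 1 (fun k => ω (n + k)) = past (n + 1) ω := by
    funext i; simp only [past]; congr 1; ring
  have h2 : future 1 (fun k => ω (n + k)) = future (n + 1) ω := by
    funext i; simp only [future]; congr 1; ring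
  rw [fine, fineZero, gapAt, h1, h2, ← gapAt]
  split_ifs with h <;> simp [h]

theorem HasMarkers.age_succ {K : ℕ} {ω : ℤ → SiteValue} (h : HasMarkers K ω) (n : ℤ) :
    age K (past (n + 1) ω) = nextAge K (age K (past n ω)) (future n ω 0) := by
  obtain ⟨⟨j, hj⟩, -⟩ := h n
  have h1 := past_succ_tail n ω
  rw [age_eq (h1.symm ▸ hj), h1]
  congr 2
  simp [past, future]

theorem HasMarkers.gapAt_eq {K : ℕ} {ω : ℤ → SiteValue} (h : HasMarkers K ω) (n : ℤ) :
    gapAt K n ω = gapBefore (future n ω 0) (age K (past n ω)) (gapAt K (n + 1) ω) := by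
  rw [gapAt, gap_eq (h n).2, future_tail, ← h.age_succ, ← gapAt]

/-- Gaps and words of the fine process in terms of the age and of the future. -/
theorem HasMarkers.wordAt_iff {K : ℕ} {ω : ℤ → SiteValue} (h : HasMarkers K ω) (σ : List Bool)
    (n : ℤ) (c : ℕ) :
    (gapAt K n ω = c ∧ WordAt (fine K) σ n ω) ↔
      future n ω ∈ wordSet K σ c (age K (past n ω)) := by
  induction σ generalizing n c with
  | nil => simp [WordAt, wordSet, gapAt]
  | cons b σ ih =>
    have hgap := h.gapAt_eq n
    rw [WordAt, fine_eq_one_iff]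
    cases b with
    | false =>
      rw [wordSet, Set.mem_ofPred_eq, future_tail]
      have h1 : (gapAt K n ω = c ∧ (gapAt K (n + 1) ω = 0 ↔ false = true) ∧
          WordAt (fine K) σ (n + 1) ω) ↔
          (gapAt K (n + 1) ω = c + 1 ∧ WordAt (fine K) σ (n + 1) ω) := by
        rw [hgap, gapBefore]
        split_ifs with h0
        · simp [h0]
        · simp only [h0, true_and]
          refine and_congr_left fun _ => ?_
          omega
      rw [h1, ih, h.age_succ]
      constructor
      · intro h2
        by_cases hc : IsCoarse K (age K (past n ω)) (future n ω 0)
        · have h3 := (ih (n + 1) (c + 1)).2 (h.age_succ n ▸ h2)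
          have h4 : gapAt K (n + 1) ω ≤ 0 := by
            rw [gapAt, h.age_succ n, nextAge, if_pos hc]
            exact gap_le _ _ _
          omega
        · rw [nextAge, if_neg hc] at h2
          exact ⟨hc, h2⟩
      · rintro ⟨hc, h2⟩
        rwa [nextAge, if_neg hc]
    | true =>
      rw [wordSet, Set.mem_ofPred_eq, future_tail, ← h.age_succ, ← ih, hgap, gapBefore]
      split_ifs with h0
      · simp [h0]
      · simp [h0]

theorem IsMarker.fine_eq_one {K j : ℕ} {n : ℤ} {ω : ℤ → SiteValue} (h : IsMarker K (past n ω) j) :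
    fine K (n - 1 - j) ω = 1 := by
  have h0 : IsMarker K (past (n - j) ω) 0 := by
    refine ⟨?_, fun i hi => ?_⟩
    · have := h.1
      simp only [past] at this ⊢
      rwa [show n - j - 1 - ((0 : ℕ) : ℤ) = n - 1 - j by push_cast; ring]
    · have := h.2 i hi
      simp only [past] at this ⊢
      rwa [show n - j - 1 - ((0 + 1 + i : ℕ) : ℤ) = n - 1 - ((j + 1 + i : ℕ) : ℤ) by push_cast; ring]
  rw [fine_eq_one_iff, show n - 1 - (j : ℤ) + 1 = n - j by ring, gapAt, age_eq_ageFrom h0, ageFrom]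
  exact Nat.le_zero.1 (gap_le _ _ _)

theorem measurable_past (n : ℤ) : Measurable (past n) :=
  measurable_pi_lambda _ fun i => measurable_pi_apply (n - 1 - i)

theorem measurable_future (n : ℤ) : Measurable (future n) :=
  measurable_pi_lambda _ fun i => measurable_pi_apply (n + i)

theorem measurable_fineZero (K : ℕ) : Measurable (fineZero K) := by
  have h : Measurable (gapAt K 1) := (measurable_gap K).comp
    (((measurable_age K).comp (measurable_past 1)).prodMk (measurable_future 1))
  exact Measurable.ite (h (measurableSet_singleton 0)) measurable_const measurable_const

theorem measurable_fine (K : ℕ) (n : ℤ) : Measurable (fine K n) :=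
  (measurable_fineZero K).comp (measurable_pi_lambda _ fun k => measurable_pi_apply (n + k))

/-- Both a marker at the site `-j (K + 1)` and a head at the site `j + K + 1`. -/
def IsWindow (K : ℕ) (ω : ℤ → SiteValue) (j : ℕ) : Prop :=
  IsMarker K (past 1 ω) (j * (K + 1)) ∧ (future 1 ω (K + j)).1 = true

/-- A window determines the fine process at the origin. -/
theorem IsWindow.fineZero_congr {K j : ℕ} {ω ω' : ℤ → SiteValue} (h : IsWindow K ω j)
    (hω : ∀ n : ℤ, |n| ≤ ((K + 1) * (j + 1) : ℕ) → ω n = ω' n) : fineZero K ω = fineZero K ω' := by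
  have h1 : age K (past 1 ω) = age K (past 1 ω') := by
    refine age_congr h.1 fun i hi => hω _ ?_
    rw [abs_le]
    constructor <;> push_cast <;> nlinarith
  have h2 : gap K (age K (past 1 ω)) (future 1 ω) = gap K (age K (past 1 ω)) (future 1 ω') := by
    refine gap_congr h.2 (by omega) fun i hi => hω _ ?_
    rw [abs_le]
    constructor <;> push_cast <;> nlinarith
  rw [fineZero, fineZero, gapAt, gapAt, h2, h1]

/-! ### Markers, stationarity and words of the fine process -/

/-- The sites that decide whether the `j`-th window exists; those of different windows are
different. -/
def windowSite (K : ℕ) (x : ℕ × Option (Fin (K + 1))) : ℤ :=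
  match x.2 with
  | none => K + 1 + x.1
  | some i => -(x.1 * (K + 1) + i)

theorem windowSite_injective (K : ℕ) : Function.Injective (windowSite K) := by
  rintro ⟨j, _ | i⟩ ⟨j', _ | i'⟩ h
  · simp only [windowSite] at h
    have : j = j' := by omega
    rw [this]
  · simp only [windowSite] at h
    have : (0 : ℤ) ≤ (j' : ℤ) * (K + 1) := by positivity
    omega
  · simp only [windowSite] at h
    have : (0 : ℤ) ≤ (j : ℤ) * (K + 1) := by positivity
    omega
  · simp only [windowSite] at h
    have h1 : j * (K + 1) + i = j' * (K + 1) + i' := by zify; linarith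
    have h2 : j = j' := by
      have := congrArg (· / (K + 1)) h1
      simpa [Nat.mul_add_div, mul_comm _ (K + 1), Nat.div_eq_of_lt i.2, Nat.div_eq_of_lt i'.2]
        using this
    subst h2
    have h3 : i = i' := Fin.ext (by omega)
    rw [h3]

theorem isWindow_iff (K : ℕ) (ω : ℤ → SiteValue) (j : ℕ) :
    IsWindow K ω j ↔ ∀ x, (ω (windowSite K (j, x))).1 =
      x.elim true fun i => decide (i = 0) := by
  rw [Option.forall, IsWindow, IsMarker, and_comm]
  refine and_congr ?_ ?_
  · simp only [future, windowSite, Option.elim_none]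
    rw [show (1 : ℤ) + ((K + j : ℕ) : ℤ) = K + 1 + j by push_cast; ring]
  · simp only [past, windowSite, Option.elim_some]
    rw [Fin.forall_fin_succ]
    refine and_congr ?_ ⟨fun h i => ?_, fun h i hi => ?_⟩
    · simp
    · rw [decide_eq_false (Fin.succ_ne_zero i), ← h i i.2]
      congr 2; simp only [Fin.val_succ]; push_cast; ring
    · have := h ⟨i, hi⟩
      rw [decide_eq_false (Fin.succ_ne_zero _)] at this
      rw [← this]
      congr 2; simp only [Fin.val_succ]; push_cast; ring

section Law

variable {v m : ℕ → ℝ} {K : ℕ} {p : ℝ} {ρ : Measure SiteValue} {k : ℕ → ℕ → ℝ}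

/-- The windows occur independently with the same positive probability. -/
theorem IsSiteLaw.exists_real_forall_not_isWindow (h : IsSiteLaw v m K p ρ k) :
    ∃ s : ℝ, 0 < s ∧ s ≤ 1 ∧ ∀ J : ℕ,
      (Measure.infinitePi fun _ : ℤ => ρ).real {ω | ∀ j < J, ¬ IsWindow K ω j} = (1 - s) ^ J := by
  have := h.prob
  set B : Measure (Option (Fin (K + 1)) → SiteValue) := Measure.infinitePi fun _ => ρ with hB
  set t : Option (Fin (K + 1)) → Set SiteValue := fun x =>
    {a | a.1 = x.elim true fun i => decide (i = 0)} with ht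
  have htm : ∀ x, MeasurableSet (t x) := fun x => measurable_fst (measurableSet_singleton _)
  have hS : MeasurableSet (Set.pi Set.univ t) := MeasurableSet.univ_pi htm
  have h1 : B (Set.pi Set.univ t) = ∏ x, ρ (t x) := by
    rw [hB, Measure.infinitePi_pi_univ _ htm, tprod_fintype]
  have hpos : 0 < B.real (Set.pi Set.univ t) := by
    rw [measureReal_def, h1, ENNReal.toReal_prod]
    refine Finset.prod_pos fun x _ => ?_
    change 0 < ρ.real (t x)
    rw [ht, h.coin]
    split_ifs
    · exact h.p_pos
    · linarith [h.p_lt_one]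
  refine ⟨B.real (Set.pi Set.univ t), hpos, measureReal_le_one, fun J => ?_⟩
  have h2 : (Measure.infinitePi fun _ : ℤ => ρ).map
      (fun ω j x => ω (windowSite K (j, x))) = Measure.infinitePi fun _ : ℕ => B := by
    rw [hB, ← Measure.infinitePi_map_curry (fun _ : ℕ => fun _ : Option (Fin (K + 1)) => ρ),
      ← Measure.map_infinitePi_infinitePi_of_inj (P := fun _ : ℤ => ρ) (windowSite_injective K),
      Measure.map_map (by fun_prop) (by fun_prop)]
    rfl
  have h3 : {ω | ∀ j < J, ¬ IsWindow K ω j} = (fun ω j x => ω (windowSite K (j, x))) ⁻¹'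
      Set.pi (Finset.range J) (fun _ : ℕ => (Set.pi Set.univ t)ᶜ) := by
    ext ω
    simp [isWindow_iff, Set.mem_pi, ht]
  rw [h3, measureReal_def, ← Measure.map_apply (by fun_prop)
    (MeasurableSet.pi (Finset.countable_toSet _) fun _ _ => hS.compl), h2,
    Measure.infinitePi_pi _ fun _ _ => hS.compl, Finset.prod_const, Finset.card_range,
    ENNReal.toReal_pow, ← measureReal_def, probReal_compl_eq_one_sub hS]

theorem IsSiteLaw.ae_exists_isWindow (h : IsSiteLaw v m K p ρ k) :
    ∀ᵐ ω ∂(Measure.infinitePi fun _ : ℤ => ρ), ∃ j, IsWindow K ω j := by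
  have := h.prob
  obtain ⟨s, hs0, hs1, hs⟩ := h.exists_real_forall_not_isWindow
  have h1 : (Measure.infinitePi fun _ : ℤ => ρ).real {ω | ¬ ∃ j, IsWindow K ω j} ≤ 0 := by
    refine ge_of_tendsto' (tendsto_pow_atTop_nhds_zero_of_lt_one (r := 1 - s)
      (by linarith) (by linarith)) fun J => ?_
    rw [← hs J]
    refine measureReal_mono fun ω hω j _ => ?_
    exact fun hj => hω ⟨j, hj⟩
  rw [ae_iff]
  exact (measureReal_eq_zero_iff (measure_ne_top _ _)).1 (le_antisymm h1 measureReal_nonneg)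

theorem measurePreserving_shift [IsProbabilityMeasure ρ] (n : ℤ) :
    MeasurePreserving (fun (ω : ℤ → SiteValue) k => ω (n + k)) (Measure.infinitePi fun _ : ℤ => ρ)
      (Measure.infinitePi fun _ : ℤ => ρ) :=
  ⟨by fun_prop, Measure.map_infinitePi_infinitePi_of_inj (f := fun k : ℤ => n + k)
    (add_right_injective n)⟩

theorem IsSiteLaw.ae_hasMarkers (h : IsSiteLaw v m K p ρ k) :
    ∀ᵐ ω ∂(Measure.infinitePi fun _ : ℤ => ρ), HasMarkers K ω := by
  have := h.prob
  refine ae_all_iff.2 fun n => ?_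
  have h1 := (measurePreserving_shift (ρ := ρ) (n - 1)).quasiMeasurePreserving.ae
    h.ae_exists_isWindow
  have h2 : MeasurePreserving (future n) (Measure.infinitePi fun _ : ℤ => ρ)
      (Measure.infinitePi fun _ : ℕ => ρ) :=
    ⟨measurable_future n, Measure.map_infinitePi_infinitePi_of_inj (P := fun _ : ℤ => ρ)
      (f := fun i : ℕ => n + (i : ℤ)) fun i j hij => by simpa using hij⟩
  filter_upwards [h1, h2.quasiMeasurePreserving.ae (ae_frequent h)] with ω ⟨j, hj⟩ hf
  refine ⟨⟨j * (K + 1), ?_⟩, hf⟩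
  have h3 : past 1 (fun k => ω (n - 1 + k)) = past n ω := by
    funext i; simp only [past]; congr 1; ring
  exact h3 ▸ hj.1

theorem IsSiteLaw.ae_exists_fine (h : IsSiteLaw v m K p ρ k) :
    ∀ᵐ ω ∂(Measure.infinitePi fun _ : ℤ => ρ), ∀ n : ℤ, ∃ n' < n, fine K n' ω = 1 := by
  filter_upwards [h.ae_hasMarkers] with ω hω n
  obtain ⟨⟨j, hj⟩, -⟩ := hω n
  exact ⟨n - 1 - j, by omega, hj.fine_eq_one⟩

theorem isStationaryProcess_fine [IsProbabilityMeasure ρ] (K : ℕ) :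
    IsStationaryProcess (fine K) (Measure.infinitePi fun _ : ℤ => ρ) := by
  intro n
  have hm : Measurable fun ω (k : ℤ) => fine K k ω :=
    measurable_pi_lambda _ fun k => measurable_fine K k
  have hm' : Measurable fun ω (k : ℤ) => fine K (k + n) ω :=
    measurable_pi_lambda _ fun k => measurable_fine K (k + n)
  refine ⟨hm'.aemeasurable, hm.aemeasurable, ?_⟩
  have h1 := (measurePreserving_shift (ρ := ρ) n)
  conv_rhs => rw [← h1.map_eq]
  rw [Measure.map_map hm h1.measurable]
  congr 1
  funext ω k
  simp only [Function.comp, fine]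
  congr 1
  funext l
  congr 1
  ring

/-- The words after a one in the fine process have the probabilities of a renewal process, up to a
common factor. The past, which determines the age, is independent of the future. -/
theorem IsSiteLaw.exists_measure_wordAt (h : IsSiteLaw v m K p ρ k) :
    ∃ c : ENNReal, ∀ σ : List Bool, (Measure.infinitePi fun _ : ℤ => ρ)
      {ω | fine K 0 ω = 1 ∧ WordAt (fine K) σ 1 ω} = c * ENNReal.ofReal (wordWeight v σ 0) := by
  have := h.prob
  set P := Measure.infinitePi fun _ : ℤ => ρ with hP
  set Q := Measure.infinitePi fun _ : ℕ => ρ with hQ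
  refine ⟨∫⁻ z, ENNReal.ofReal (m (age K z) / geomTail K p (age K z)) ∂Q, fun σ => ?_⟩
  set S : Set ((ℕ → SiteValue) × (ℕ → SiteValue)) := {x | x.2 ∈ wordSet K σ 0 (age K x.1)} with hS
  have hSm : MeasurableSet S := by
    have : S = ⋃ α, {x | age K x.1 = α} ∩ {x | x.2 ∈ wordSet K σ 0 α} := by
      ext x; simp [hS]
    rw [this]
    exact MeasurableSet.iUnion fun α =>
      (((measurable_age K).comp measurable_fst) (measurableSet_singleton α)).inter
        (measurable_snd (measurableSet_wordSet K σ 0 α))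
  have h1 := map_infinitePi_prodMk ρ (f := fun i : ℕ => (1 : ℤ) - 1 - i)
    (g := fun i : ℕ => (1 : ℤ) + i) (by
      rintro (i | i) (j | j) hij <;> simp only [Sum.elim_inl, Sum.elim_inr] at hij
      · congr 1; omega
      · omega
      · omega
      · congr 1; omega)
  have h2 : P {ω | fine K 0 ω = 1 ∧ WordAt (fine K) σ 1 ω} =
      P ((fun ω => (past 1 ω, future 1 ω)) ⁻¹' S) := by
    refine measure_congr ?_
    filter_upwards [h.ae_hasMarkers] with ω hω
    refine propext ?_
    change (fine K 0 ω = 1 ∧ WordAt (fine K) σ 1 ω) ↔ future 1 ω ∈ wordSet K σ 0 (age K (past 1 ω))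
    rw [fine_eq_one_iff, zero_add]
    exact hω.wordAt_iff σ 1 0
  rw [h2, ← Measure.map_apply ((measurable_past 1).prodMk (measurable_future 1)) hSm]
  change (P.map fun ω => (fun i : ℕ => ω (1 - 1 - i), fun i : ℕ => ω (1 + i))) S = _
  rw [h1, Measure.prod_apply hSm, ← lintegral_mul_const']
  · refine lintegral_congr fun z => ?_
    have h3 := h.real_wordSet σ (Nat.zero_le (age K z))
    have hpos := geomTail_pos (K := K) h.p_lt_one (age K z)
    rw [← ENNReal.ofReal_mul (div_nonneg (h.m_nonneg _) hpos.le)]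
    change Q (wordSet K σ 0 (age K z)) = _
    rw [← ofReal_measureReal, ← hQ] at *
    congr 1
    rw [Nat.sub_zero] at h3
    rw [div_mul_eq_mul_div, ← h3, mul_div_cancel_right₀ _ hpos.ne']
  · exact ENNReal.ofReal_ne_top

end Law

/-! ### The coding window -/

open Classical in
/-- The coding window of the fine process at the origin: a radius of an interval around the origin
that contains the sites of the first window. -/
noncomputable def codingWindow (K : ℕ) (ω : ℤ → SiteValue) : WithTop ℕ :=
  if h : ∃ j, IsWindow K ω j then (((K + 1) * (Nat.find h + 1) : ℕ) : WithTop ℕ) else ⊤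

theorem codingWindow_le_iff {K r : ℕ} {ω : ℤ → SiteValue} :
    codingWindow K ω ≤ r ↔ ∃ j, (K + 1) * (j + 1) ≤ r ∧ IsWindow K ω j := by
  classical
  unfold codingWindow
  split_ifs with h
  · rw [Nat.cast_le]
    refine ⟨fun h1 => ⟨_, h1, Nat.find_spec h⟩, ?_⟩
    rintro ⟨j, hj, hw⟩
    have := Nat.find_min' h hw
    exact le_trans (Nat.mul_le_mul_left _ (by omega)) hj
  · simp only [top_le_iff, WithTop.natCast_ne_top, false_iff]
    rintro ⟨j, -, hw⟩
    exact h ⟨j, hw⟩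

theorem measurable_eval (n : ℤ) : Measurable fun ω : ℤ → SiteValue => ω n := measurable_pi_apply n

/-- The filtration of the windows of the i.i.d. process. -/
def siteFiltration : Filtration ℕ (inferInstance : MeasurableSpace (ℤ → SiteValue)) :=
  windowFiltration (fun (n : ℤ) (ω : ℤ → SiteValue) => ω n) measurable_eval

theorem measurable_eval_siteFiltration {n : ℤ} {r : ℕ} (h : |n| ≤ r) :
    Measurable[siteFiltration r] fun ω : ℤ → SiteValue => ω n := by
  refine Measurable.mono (comap_measurable _) ?_ le_rfl
  exact le_iSup₂ (f := fun (n : ℤ) (_ : |n| ≤ (r : ℤ)) =>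
    MeasurableSpace.comap (fun ω : ℤ → SiteValue => ω n) inferInstance) n h

theorem measurableSet_isWindow {K j r : ℕ} (hr : (K + 1) * (j + 1) ≤ r) :
    MeasurableSet[siteFiltration r] {ω | IsWindow K ω j} := by
  have h1 : {ω | IsWindow K ω j} = ⋂ x, {ω : ℤ → SiteValue | (ω (windowSite K (j, x))).1 =
      x.elim true fun i => decide (i = 0)} := by
    ext ω; simp only [Set.mem_ofPred_eq, isWindow_iff, Set.mem_iInter]
  rw [h1]
  refine MeasurableSet.iInter fun x => ?_
  have h2 : |windowSite K (j, x)| ≤ r := by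
    zify at hr
    rw [abs_le]
    cases x with
    | none => simp only [windowSite]; constructor <;> nlinarith
    | some i => have := i.2; simp only [windowSite]; constructor <;> nlinarith
  exact (measurable_fst.comp (measurable_eval_siteFiltration h2)) (measurableSet_singleton _)

theorem isStoppingTime_codingWindow (K : ℕ) : IsStoppingTime siteFiltration (codingWindow K) := by
  intro r
  have h1 : {ω | codingWindow K ω ≤ r} =
      ⋃ j ∈ {j | (K + 1) * (j + 1) ≤ r}, {ω | IsWindow K ω j} := by
    ext ω; simp [codingWindow_le_iff]
  change MeasurableSet[siteFiltration r] {ω | codingWindow K ω ≤ r}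
  rw [h1]
  exact MeasurableSet.biUnion (Set.to_countable _) fun j hj => measurableSet_isWindow hj

/-- Outside of `[-r, r]` the values are replaced by a fixed one. -/
def truncateSites (r : ℕ) (ω : ℤ → SiteValue) (n : ℤ) : SiteValue := if |n| ≤ r then ω n else default

theorem measurable_truncateSites (r : ℕ) : Measurable[siteFiltration r] (truncateSites r) := by
  refine @measurable_pi_lambda _ _ _ (siteFiltration r) _ _ fun n => ?_
  unfold truncateSites
  split_ifs with h
  · exact measurable_eval_siteFiltration h
  · exact measurable_const

theorem measurable_fineZero_stopped (K : ℕ) :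
    Measurable[(isStoppingTime_codingWindow K).measurableSpace] (fineZero K) := by
  intro s hs
  refine ⟨?_, fun r => ?_⟩
  · have h1 : (inferInstance : MeasurableSpace (ℤ → SiteValue)) ≤ ⨆ r, siteFiltration r := by
      refine iSup_le fun n => ?_
      rw [← measurable_iff_comap_le]
      exact (measurable_eval_siteFiltration (n := n) (r := n.natAbs) (by simp)).mono
        (le_iSup (fun r => siteFiltration r) _) le_rfl
    exact h1 _ (measurable_fineZero K hs)
  · have h1 : fineZero K ⁻¹' s ∩ {ω | codingWindow K ω ≤ r} =
        (fun ω => fineZero K (truncateSites r ω)) ⁻¹' s ∩ {ω | codingWindow K ω ≤ r} := by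
      ext ω
      refine and_congr_left fun hω => ?_
      obtain ⟨j, hj, hw⟩ := codingWindow_le_iff.1 hω
      rw [Set.mem_preimage, Set.mem_preimage]
      rw [hw.fineZero_congr (ω' := truncateSites r ω) fun n hn => ?_]
      rw [truncateSites, if_pos (hn.trans (by exact_mod_cast hj))]
    change MeasurableSet[siteFiltration r] (fineZero K ⁻¹' s ∩ {ω | codingWindow K ω ≤ r})
    rw [h1]
    exact (((measurable_fineZero K).comp (measurable_truncateSites r)) hs).inter
      (isStoppingTime_codingWindow K r)

theorem IsSiteLaw.hasExponentialTails_codingWindow {v m : ℕ → ℝ} {K : ℕ} {p : ℝ}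
    {ρ : Measure SiteValue} {k : ℕ → ℕ → ℝ} (h : IsSiteLaw v m K p ρ k) :
    HasExponentialTails (codingWindow K) (Measure.infinitePi fun _ : ℤ => ρ) := by
  have := h.prob
  obtain ⟨s, hs0, hs1, hs⟩ := h.exists_real_forall_not_isWindow
  set q : ℝ := max (1 - s) (1 / 2) with hq
  have hq0 : 0 < q := lt_max_of_lt_right (by norm_num)
  have hq1 : q < 1 := max_lt (by linarith) (by norm_num)
  have hlog : Real.log q < 0 := Real.log_neg hq0 hq1
  refine ⟨q⁻¹, -Real.log q / (K + 1), by positivity, div_pos (by linarith) (by positivity),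
    fun t ht => ?_⟩
  -- the first `J` windows are contained in `[-(t - 1), t - 1]`
  set J := (t - 1) / (K + 1) with hJ
  have h1 : (Measure.infinitePi fun _ : ℤ => ρ).real {ω | (t : WithTop ℕ) ≤ codingWindow K ω} ≤
      q ^ J := by
    calc _ ≤ (Measure.infinitePi fun _ : ℤ => ρ).real {ω | ∀ j < J, ¬ IsWindow K ω j} := by
          refine measureReal_mono fun ω hω j hj hw => ?_
          have h2 : (K + 1) * (j + 1) ≤ t - 1 :=
            (Nat.mul_le_mul_left _ hj).trans (Nat.mul_div_le _ _)
          have h3 := le_trans hω (codingWindow_le_iff.2 ⟨j, h2, hw⟩)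
          have h4 : t ≤ t - 1 := Nat.cast_le.1 h3
          omega
      _ = (1 - s) ^ J := hs J
      _ ≤ q ^ J := pow_le_pow_left₀ (by linarith) (le_max_left _ _) _
  refine h1.trans ?_
  have h2 : t ≤ (K + 1) * (J + 1) := by
    have := Nat.lt_mul_div_succ (t - 1) (Nat.succ_pos K)
    rw [Nat.succ_eq_add_one, ← hJ] at this
    omega
  have h3 : (t : ℝ) / (K + 1) ≤ J + 1 := by
    rw [div_le_iff₀ (by positivity)]
    have : (t : ℝ) ≤ (K + 1) * (J + 1) := by exact_mod_cast h2
    linarith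
  calc q ^ J = q⁻¹ * q ^ (J + 1) := by rw [pow_succ]; field_simp
    _ = q⁻¹ * Real.exp (Real.log q * (J + 1)) := by
      rw [← Real.rpow_natCast q (J + 1), Real.rpow_def_of_pos hq0]; push_cast; rfl
    _ ≤ q⁻¹ * Real.exp (-(-Real.log q / (K + 1)) * t) := by
      refine mul_le_mul_of_nonneg_left (Real.exp_le_exp.2 ?_) (by positivity)
      calc Real.log q * (J + 1) ≤ Real.log q * (t / (K + 1)) :=
            mul_le_mul_of_nonpos_left h3 hlog.le
        _ = _ := by ring

/-! ### Stationary processes are determined by their words -/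

theorem wordAt_shift {Ω : Type*} {X : ℤ → Ω → Fin 2} (σ : List Bool) (n l : ℤ) (ω : Ω) :
    WordAt X σ (n + l) ω ↔ WordAt (fun k => X (k + l)) σ n ω := by
  induction σ generalizing n with
  | nil => rfl
  | cons b σ ih => rw [WordAt, WordAt, ← ih, show n + l + 1 = n + 1 + l by ring]

theorem wordAt_coordinate {Ω : Type*} {X : ℤ → Ω → Fin 2} (σ : List Bool) (n : ℤ) (ω : Ω) :
    WordAt X σ n ω ↔ WordAt (fun k (x : ℤ → Fin 2) => x k) σ n fun k => X k ω := by
  induction σ generalizing n with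
  | nil => rfl
  | cons b σ ih => rw [WordAt, WordAt, ih]

theorem wordAt_append {Ω : Type*} {X : ℤ → Ω → Fin 2} {σ τ : List Bool} {n : ℤ} {ω : Ω} :
    WordAt X (σ ++ τ) n ω ↔ WordAt X σ n ω ∧ WordAt X τ (n + σ.length) ω := by
  induction σ generalizing n with
  | nil => simp [WordAt]
  | cons b σ ih =>
    rw [List.cons_append, WordAt, WordAt, ih, and_assoc, List.length_cons,
      show n + 1 + (σ.length : ℤ) = n + ((σ.length + 1 : ℕ) : ℤ) by push_cast; ring]

theorem wordAt_replicate_false {Ω : Type*} {X : ℤ → Ω → Fin 2} {c : ℕ} {n : ℤ} {ω : Ω} :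
    WordAt X (List.replicate c false) n ω ↔ ∀ i < c, X (n + i) ω ≠ 1 := by
  induction c generalizing n with
  | zero => simp [WordAt]
  | succ c ih =>
    rw [List.replicate_succ, WordAt, ih]
    constructor
    · rintro ⟨h1, h2⟩ i hi
      cases i with
      | zero => simpa using h1
      | succ i =>
        have := h2 i (by omega)
        rwa [show n + ((i + 1 : ℕ) : ℤ) = n + 1 + i by push_cast; ring]
    · refine fun h => ⟨by simpa using h 0 (by omega), fun i hi => ?_⟩
      have := h (i + 1) (by omega)
      rwa [show n + ((i + 1 : ℕ) : ℤ) = n + 1 + i by push_cast; ring] at this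

section Words

variable {Ω : Type*} [MeasurableSpace Ω] {X : ℤ → Ω → Fin 2}

theorem measurableSet_wordAt (hX : ∀ n, Measurable (X n)) (σ : List Bool) (n : ℤ) :
    MeasurableSet {ω | WordAt X σ n ω} := by
  induction σ generalizing n with
  | nil => simp [WordAt]
  | cons b σ ih =>
    refine MeasurableSet.inter (s₁ := {ω | X n ω = 1 ↔ b = true}) ?_ (ih (n + 1))
    have h1 : MeasurableSet {ω | X n ω = 1} := hX n (measurableSet_singleton 1)
    cases b with
    | true => convert h1 using 1; ext; simp
    | false => convert h1.compl using 1; ext; simp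

theorem measure_wordAt_shift {μ : Measure Ω} (hs : IsStationaryProcess X μ) (σ : List Bool)
    (n l : ℤ) : μ {ω | WordAt X σ (n + l) ω} = μ {ω | WordAt X σ n ω} := by
  simp_rw [wordAt_shift, wordAt_coordinate (X := X), wordAt_coordinate (X := fun k => X (k + l))]
  exact (hs l).measure_mem_eq (measurableSet_wordAt (fun n => measurable_pi_apply n) σ n)

/-- A word is split according to the last one before it. -/
theorem measure_wordAt_eq_tsum {μ : Measure Ω} (hX : ∀ n, Measurable (X n))
    (hs : IsStationaryProcess X μ) (hrec : ∀ᵐ ω ∂μ, ∃ n < 0, X n ω = 1) (σ : List Bool) :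
    μ {ω | WordAt X σ 0 ω} =
      ∑' c : ℕ, μ {ω | X 0 ω = 1 ∧ WordAt X (List.replicate c false ++ σ) 1 ω} := by
  set S : ℕ → Set Ω := fun c =>
    {ω | WordAt X (true :: (List.replicate c false ++ σ)) (-1 - c) ω} with hS
  have hSiff : ∀ c ω, ω ∈ S c ↔ X (-1 - c) ω = 1 ∧ (∀ i < c, X (-1 - c + 1 + i) ω ≠ 1) ∧
      WordAt X σ 0 ω := by
    intro c ω
    rw [hS, Set.mem_ofPred_eq, WordAt, wordAt_append, wordAt_replicate_false, List.length_replicate,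
      show -1 - (c : ℤ) + 1 + c = 0 by ring]
    simp
  have hSm : ∀ c, MeasurableSet (S c) := fun c => measurableSet_wordAt hX _ _
  have h1 : μ {ω | WordAt X σ 0 ω} = μ (⋃ c, S c) := by
    refine measure_congr ?_
    filter_upwards [hrec] with ω ⟨n, hn, hXn⟩
    refine propext ?_
    change WordAt X σ 0 ω ↔ ω ∈ ⋃ c, S c
    simp only [Set.mem_iUnion, hSiff]
    refine ⟨fun h => ?_, fun ⟨_, _, _, h⟩ => h⟩
    classical
    have hex : ∃ c : ℕ, X (-1 - c) ω = 1 :=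
      ⟨(-1 - n).toNat, by rwa [Int.toNat_of_nonneg (by omega), sub_sub_cancel]⟩
    refine ⟨Nat.find hex, Nat.find_spec hex, fun i hi hX1 => ?_, h⟩
    refine Nat.find_min hex (m := Nat.find hex - 1 - i) (by omega) ?_
    rw [show (-1 : ℤ) - ((Nat.find hex - 1 - i : ℕ) : ℤ) = -1 - (Nat.find hex : ℤ) + 1 + i by omega]
    exact hX1
  rw [h1, measure_iUnion ?_ hSm]
  · refine tsum_congr fun c => ?_
    have := measure_wordAt_shift hs (true :: (List.replicate c false ++ σ)) 0 (-1 - c)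
    rw [zero_add] at this
    rw [hS, this]
    simp [WordAt]
  · have : ∀ c c' : ℕ, c < c' → Disjoint (S c) (S c') := by
      intro c c' hcc'
      rw [Set.disjoint_left]
      intro ω h h'
      rw [hSiff] at h h'
      refine h'.2.1 (c' - 1 - c) (by omega) ?_
      rw [show (-1 : ℤ) - c' + 1 + ((c' - 1 - c : ℕ) : ℤ) = -1 - c by omega]
      exact h.1
    intro c c' hne
    rcases hne.lt_or_gt with h | h
    · exact this c c' h
    · exact (this c' c h).symm

end Words

/-- The words determine the law of a stationary process. -/
theorem identDistrib_of_measure_wordAt_eq {Ω Ω' : Type*} [MeasurableSpace Ω] [MeasurableSpace Ω']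
    {μ : Measure Ω} {P : Measure Ω'} [IsProbabilityMeasure μ] [IsProbabilityMeasure P]
    {X : ℤ → Ω → Fin 2} {X' : ℤ → Ω' → Fin 2} (hX : ∀ n, Measurable (X n))
    (hX' : ∀ n, Measurable (X' n)) (hs : IsStationaryProcess X μ) (hs' : IsStationaryProcess X' P)
    (h : ∀ σ, P {ω | WordAt X' σ 0 ω} = μ {ω | WordAt X σ 0 ω}) :
    IdentDistrib (fun ω (n : ℤ) => X' n ω) (fun ω (n : ℤ) => X n ω) P μ := by
  have hm : Measurable fun ω (n : ℤ) => X n ω := measurable_pi_lambda _ hX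
  have hm' : Measurable fun ω (n : ℤ) => X' n ω := measurable_pi_lambda _ hX'
  refine ⟨hm'.aemeasurable, hm.aemeasurable, ?_⟩
  have := Measure.isProbabilityMeasure_map (μ := μ) hm.aemeasurable
  have := Measure.isProbabilityMeasure_map (μ := P) hm'.aemeasurable
  -- the cylinders that prescribe the values on an interval form a generating π-system
  set word : (ℤ → Fin 2) → ℤ → ℕ → List Bool := fun x n l =>
    List.ofFn fun i : Fin l => decide (x (n + i) = 1) with hword
  have hwordAt : ∀ (x z : ℤ → Fin 2) (l : ℕ) (n : ℤ),
      WordAt (fun k (x : ℤ → Fin 2) => x k) (word x n l) n z ↔ ∀ i < l, z (n + i) = x (n + i) := by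
    intro x z l
    induction l with
    | zero => intro n; simp [hword, WordAt]
    | succ l ih =>
      intro n
      have h1 : word x n (l + 1) = decide (x n = 1) :: word x (n + 1) l := by
        simp only [hword, List.ofFn_succ]
        congr 1
        · simp
        · refine congrArg List.ofFn (funext fun i => ?_)
          rw [Fin.val_succ, show n + ((i + 1 : ℕ) : ℤ) = n + 1 + i by push_cast; ring]
      have hfin : ∀ a b : Fin 2, (a = 1 ↔ decide (b = 1) = true) ↔ a = b := by decide
      rw [h1, WordAt, ih, hfin]
      constructor
      · rintro ⟨h1, h2⟩ i hi
        cases i with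
        | zero => simpa using h1
        | succ i =>
          have := h2 i (by omega)
          rwa [show n + ((i + 1 : ℕ) : ℤ) = n + 1 + i by push_cast; ring]
      · refine fun h => ⟨by simpa using h 0 (by omega), fun i hi => ?_⟩
        have := h (i + 1) (by omega)
        rwa [show n + ((i + 1 : ℕ) : ℤ) = n + 1 + i by push_cast; ring] at this
  set cyl : ℕ → (ℤ → Fin 2) → Set (ℤ → Fin 2) := fun N x => {z | ∀ i : ℤ, |i| ≤ N → z i = x i}
    with hcyl
  have hcylword : ∀ N x, cyl N x =
      {z | WordAt (fun k (x : ℤ → Fin 2) => x k) (word x (-N) (2 * N + 1)) (-N) z} := by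
    intro N x
    ext z
    simp only [hcyl, Set.mem_ofPred_eq, hwordAt]
    constructor
    · exact fun hz i hi => hz _ (abs_le.2 ⟨by omega, by omega⟩)
    · intro hz i hi
      obtain ⟨h1, h2⟩ := abs_le.1 hi
      have := hz (i + N).toNat (by omega)
      rwa [show -(N : ℤ) + ((i + N).toNat : ℤ) = i by omega] at this
  have hcylm : ∀ N x, MeasurableSet (cyl N x) := fun N x => by
    rw [hcylword]; exact measurableSet_wordAt (fun n => measurable_pi_apply n) _ _
  refine ext_of_generate_finite {S | ∃ N x, S = cyl N x} ?_ ?_ ?_ (by simp)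
  · refine le_antisymm (iSup_le fun i => ?_) (MeasurableSpace.generateFrom_le ?_)
    · rw [← measurable_iff_comap_le]
      refine @measurable_to_countable' _ _ _ _ (_) _ fun a => ?_
      have h1 : (fun x : ℤ → Fin 2 => x i) ⁻¹' {a} =
          ⋃ f ∈ {f : Finset.Icc (-|i|) |i| → Fin 2 | ∀ h, f ⟨i, h⟩ = a},
            cyl i.natAbs fun j => if h : j ∈ Finset.Icc (-|i|) |i| then f ⟨j, h⟩ else 0 := by
        have hi : i ∈ Finset.Icc (-|i|) |i| := Finset.mem_Icc.2 (abs_le.1 le_rfl)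
        ext z
        simp only [Set.mem_preimage, Set.mem_singleton_iff, Set.mem_iUnion, hcyl,
          Set.mem_ofPred_eq, exists_prop]
        constructor
        · refine fun hz => ⟨fun j => z j, fun _ => hz, fun j hj => ?_⟩
          rw [dif_pos (Finset.mem_Icc.2 (abs_le.1 (by simpa using hj)))]
        · rintro ⟨f, hf, hz⟩
          rw [hz i (by simp), dif_pos hi, hf]
      rw [h1]
      exact MeasurableSet.biUnion (Set.to_countable _) fun f _ =>
        MeasurableSpace.measurableSet_generateFrom ⟨_, _, rfl⟩
    · rintro _ ⟨N, x, rfl⟩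
      exact hcylm N x
  · have key : ∀ N M x y z, N ≤ M → z ∈ cyl N x → z ∈ cyl M y → cyl N x ∩ cyl M y = cyl M y := by
      intro N M x y z hNM hx hy
      refine Set.inter_eq_right.2 fun w hw i hi => ?_
      have hi' : |i| ≤ (M : ℤ) := hi.trans (by exact_mod_cast hNM)
      rw [hw i hi', ← hy i hi', hx i hi]
    rintro _ ⟨N, x, rfl⟩ _ ⟨M, y, rfl⟩ ⟨z, hx, hy⟩
    rcases le_total N M with h | h
    · exact ⟨M, y, key N M x y z h hx hy⟩
    · exact ⟨N, x, by rw [Set.inter_comm]; exact key M N y x z h hy hx⟩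
  · rintro _ ⟨N, x, rfl⟩
    rw [Measure.map_apply hm' (hcylm N x), Measure.map_apply hm (hcylm N x), hcylword]
    have h1 := measure_wordAt_shift hs (word x (-N) (2 * N + 1)) 0 (-N)
    have h2 := measure_wordAt_shift hs' (word x (-N) (2 * N + 1)) 0 (-N)
    rw [zero_add, ← h] at h1
    rw [zero_add, ← h1] at h2
    simp_rw [wordAt_coordinate (X := X), wordAt_coordinate (X := X')] at h2
    exact h2

/-- The law of a stationary process in which a one occurs in the past is determined by the
probabilities of the words that follow a one at the origin, even if these are known only up to a
constant factor. -/
theorem identDistrib_of_measure_one_wordAt {Ω Ω' : Type*} [MeasurableSpace Ω]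
    [MeasurableSpace Ω'] {μ : Measure Ω} {P : Measure Ω'} [IsProbabilityMeasure μ]
    [IsProbabilityMeasure P] {X : ℤ → Ω → Fin 2} {X' : ℤ → Ω' → Fin 2}
    (hX : ∀ n, Measurable (X n)) (hX' : ∀ n, Measurable (X' n)) (hs : IsStationaryProcess X μ)
    (hs' : IsStationaryProcess X' P) (hrec : ∀ᵐ ω ∂μ, ∃ n < 0, X n ω = 1)
    (hrec' : ∀ᵐ ω ∂P, ∃ n < 0, X' n ω = 1) (w : List Bool → ENNReal) (a a' : ENNReal)
    (h : ∀ σ, μ {ω | X 0 ω = 1 ∧ WordAt X σ 1 ω} = a * w σ)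
    (h' : ∀ σ, P {ω | X' 0 ω = 1 ∧ WordAt X' σ 1 ω} = a' * w σ) :
    IdentDistrib (fun ω (n : ℤ) => X' n ω) (fun ω (n : ℤ) => X n ω) P μ := by
  have h1 : ∀ σ, μ {ω | WordAt X σ 0 ω} = a * ∑' c : ℕ, w (List.replicate c false ++ σ) := by
    intro σ
    rw [measure_wordAt_eq_tsum hX hs hrec, ← ENNReal.tsum_mul_left]
    simp_rw [h]
  have h1' : ∀ σ, P {ω | WordAt X' σ 0 ω} = a' * ∑' c : ℕ, w (List.replicate c false ++ σ) := by
    intro σ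
    rw [measure_wordAt_eq_tsum hX' hs' hrec', ← ENNReal.tsum_mul_left]
    simp_rw [h']
  have h2 := h1 []
  have h2' := h1' []
  simp only [WordAt, Set.ofPred_true, measure_univ] at h2 h2'
  have h3 : a = a' := by
    rw [ENNReal.eq_inv_of_mul_eq_one_left h2.symm, ENNReal.eq_inv_of_mul_eq_one_left h2'.symm]
  exact identDistrib_of_measure_wordAt_eq hX hX' hs hs' fun σ => by rw [h1, h1', h3]

/-! ### Words of a renewal process -/

section Jumps

variable {Ω : Type*} {X : ℤ → Ω → Fin 2}

/-- From the `k`-th on the jumps of `X` lie in the given sets. -/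
def JumpsIn (X : ℤ → Ω → Fin 2) : List (Set ℕ) → ℕ → Ω → Prop
  | [], _, _ => True
  | S :: L, k, ω => jump X k ω ∈ S ∧ JumpsIn X L (k + 1) ω

/-- The constraints on the jumps when `c` zeros after a one are followed by the word `σ`. -/
def jumpSets : List Bool → ℕ → List (Set ℕ)
  | [], c => [Set.Ioi c]
  | false :: σ, c => jumpSets σ (c + 1)
  | true :: σ, c => {c + 1} :: jumpSets σ 0

theorem onePos_lt_onePos_succ {ω : Ω} (h : {n : ℕ | X n ω = 1}.Infinite) (k : ℕ) :
    onePos X k ω < onePos X (k + 1) ω :=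
  Nat.nth_strictMono h (Nat.lt_succ_self k)

theorem eq_one_iff_jump_eq {ω : Ω} (h : {n : ℕ | X n ω = 1}.Infinite) {k c : ℕ}
    (hc : c < jump X k ω) : X (onePos X k ω + c + 1 : ℕ) ω = 1 ↔ jump X k ω = c + 1 := by
  have hlt := onePos_lt_onePos_succ h k
  unfold jump at hc ⊢
  constructor
  · intro h1
    by_contra hne
    have h2 : onePos X k ω + c + 1 ≤ onePos X k ω :=
      Nat.le_nth_of_lt_nth_succ (p := fun n : ℕ => X n ω = 1) (k := k)
        (by change _ < onePos X (k + 1) ω; omega) h1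
    omega
  · intro h1
    have h2 : X (onePos X (k + 1) ω : ℕ) ω = 1 := Nat.nth_mem_of_infinite h (k + 1)
    rwa [show onePos X (k + 1) ω = onePos X k ω + c + 1 by omega] at h2

/-- The word that follows `c` zeros after the `k`-th one, in terms of the jumps from the `k`-th on. -/
theorem wordAt_iff_jumpsIn {ω : Ω} (h : {n : ℕ | X n ω = 1}.Infinite) (σ : List Bool) (k c : ℕ) :
    (c < jump X k ω ∧ WordAt X σ (onePos X k ω + c + 1 : ℕ) ω) ↔
      JumpsIn X (jumpSets σ c) k ω := by
  induction σ generalizing k c with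
  | nil => simp [WordAt, jumpSets, JumpsIn]
  | cons b σ ih =>
    have hcast : ∀ n : ℕ, (n : ℤ) + 1 = ((n + 1 : ℕ) : ℤ) := fun n => by push_cast; rfl
    cases b with
    | false =>
      rw [jumpSets, ← ih, WordAt, hcast, ← add_assoc]
      constructor
      · rintro ⟨h1, h2, h3⟩
        rw [eq_one_iff_jump_eq h h1] at h2
        exact ⟨by simp at h2; omega, h3⟩
      · rintro ⟨h1, h3⟩
        refine ⟨by omega, ?_, h3⟩
        rw [eq_one_iff_jump_eq h (by omega)]
        simp
        omega
    | true =>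
      rw [jumpSets, JumpsIn, ← ih, WordAt, hcast, Set.mem_singleton_iff]
      have h4 := onePos_lt_onePos_succ h k
      have h5 := onePos_lt_onePos_succ h (k + 1)
      constructor
      · rintro ⟨h1, h2, h3⟩
        have h6 := (eq_one_iff_jump_eq h h1).1 (h2.2 rfl)
        refine ⟨h6, by unfold jump; omega, ?_⟩
        unfold jump at h6
        rwa [show onePos X (k + 1) ω + 0 + 1 = onePos X k ω + c + 1 + 1 by omega]
      · rintro ⟨h6, -, h3⟩
        refine ⟨by omega, ?_, ?_⟩
        · rw [eq_one_iff_jump_eq h (by omega)]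
          simpa using h6
        · unfold jump at h6
          rwa [show onePos X (k + 1) ω + 0 + 1 = onePos X k ω + c + 1 + 1 by omega] at h3

theorem jumpsIn_iff {ω : Ω} (L : List (Set ℕ)) (k : ℕ) :
    JumpsIn X L k ω ↔ ∀ i ∈ Finset.range L.length, jump X (k + i) ω ∈ L.getD i Set.univ := by
  induction L generalizing k with
  | nil => simp [JumpsIn]
  | cons S L ih =>
    simp only [JumpsIn, ih, Finset.mem_range, List.length_cons]
    constructor
    · rintro ⟨h1, h2⟩ i hi
      cases i with
      | zero => simpa using h1
      | succ i =>
        have := h2 i (by omega)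
        rwa [show k + (i + 1) = k + 1 + i by ring]
    · refine fun h => ⟨by simpa using h 0 (by omega), fun i hi => ?_⟩
      have := h (i + 1) (by omega)
      rwa [show k + (i + 1) = k + 1 + i by ring] at this

end Jumps

section Renewal

variable {Ω : Type*} [MeasurableSpace Ω] {μ : Measure Ω} {X : ℤ → Ω → Fin 2} {ν : Measure ℕ}

theorem measure_jumpsIn (hX : IsStationaryRenewalProcess X ν μ) (L : List (Set ℕ)) :
    cond μ {ω | X 0 ω = 1} {ω | JumpsIn X L 0 ω} = (L.map ν).prod := by
  have h1 : {ω | JumpsIn X L 0 ω} =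
      ⋂ i ∈ Finset.range L.length, jump X i ⁻¹' L.getD i Set.univ := by
    ext ω; simp only [Set.mem_ofPred_eq, jumpsIn_iff, zero_add, Set.mem_iInter, Set.mem_preimage]
  rw [h1, hX.iIndepFun_jump.measure_inter_preimage_eq_mul _ fun i _ =>
    (Set.to_countable _).measurableSet]
  have h2 : ∀ i (S : Set ℕ), cond μ {ω | X 0 ω = 1} (jump X i ⁻¹' S) = ν S := fun i S => by
    rw [← (hX.hasLaw_jump i).map_eq, Measure.map_apply_of_aemeasurable
      (hX.hasLaw_jump i).aemeasurable (Set.to_countable _).measurableSet]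
  simp only [h2]
  clear h1
  induction L with
  | nil => simp
  | cons S L ih =>
    rw [List.length_cons, Finset.prod_range_succ', List.map_cons, List.prod_cons, mul_comm, ← ih]
    simp

theorem IsStationaryRenewalProcess.measure_one_ne_zero (hX : IsStationaryRenewalProcess X ν μ)
    (hν : IsNonLattice ν) : μ {ω | X 0 ω = 1} ≠ 0 := by
  intro h0
  have h1 : ν = 0 := by
    rw [← (hX.hasLaw_jump 0).map_eq, ProbabilityTheory.cond, Measure.restrict_eq_zero.2 h0, smul_zero,
      Measure.map_zero]
  have h2 := hν ⊥ fun t ht => absurd (by rw [h1]; rfl) ht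
  exact bot_ne_top h2

theorem IsStationaryRenewalProcess.isProbabilityMeasure [IsProbabilityMeasure μ]
    (hX : IsStationaryRenewalProcess X ν μ)
    (hν : IsNonLattice ν) : IsProbabilityMeasure ν := by
  have := cond_isProbabilityMeasure (hX.measure_one_ne_zero hν)
  rw [← (hX.hasLaw_jump 0).map_eq]
  exact Measure.isProbabilityMeasure_map (hX.hasLaw_jump 0).aemeasurable

theorem IsStationaryRenewalProcess.ae_infinite (hX : IsStationaryRenewalProcess X ν μ) :
    ∀ᵐ ω ∂cond μ {ω | X 0 ω = 1}, {n : ℕ | X n ω = 1}.Infinite := by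
  filter_upwards [cond_absolutelyContinuous.ae_le hX.recurrent] with ω hω
  refine Set.infinite_of_forall_exists_gt fun N => ?_
  obtain ⟨n, hn, hX1⟩ := (hω N).1
  refine ⟨n.toNat, ?_, by omega⟩
  rw [Set.mem_ofPred_eq, Int.toNat_of_nonneg (by omega)]
  exact hX1

theorem IsStationaryRenewalProcess.measure_zero
    (hX : IsStationaryRenewalProcess X ν μ) :
    ν {0} = 0 := by
  rw [← (hX.hasLaw_jump 0).map_eq, Measure.map_apply_of_aemeasurable
      (hX.hasLaw_jump 0).aemeasurable (measurableSet_singleton 0), measure_eq_zero_iff_ae_notMem]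
  filter_upwards [hX.ae_infinite] with ω hω h0
  have h1 := onePos_lt_onePos_succ hω 0
  have h2 : jump X 0 ω = 0 := h0
  unfold jump at h2
  omega

theorem IsStationaryRenewalProcess.tailSeq_eq [IsProbabilityMeasure μ]
    (hX : IsStationaryRenewalProcess X ν μ)
    (hν : IsNonLattice ν) (c : ℕ) :
    tailSeq (fun k => ν.real {k + 1}) c = ν.real (Set.Ioi c) := by
  have := hX.isProbabilityMeasure hν
  induction c with
  | zero =>
    have h1 : Set.Ioi 0 = ({0} : Set ℕ)ᶜ := by ext t; simp [Nat.pos_iff_ne_zero]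
    rw [tailSeq_zero, h1, probReal_compl_eq_one_sub (measurableSet_singleton 0), measureReal_def,
      hX.measure_zero]
    simp
  | succ c ih =>
    have h1 : Set.Ioi c = {c + 1} ∪ Set.Ioi (c + 1) := by ext t; simp
    rw [tailSeq_succ, ih, h1, measureReal_union (by simp) (Set.to_countable _).measurableSet]
    ring

/-- The words after a one at the origin. -/
theorem IsStationaryRenewalProcess.measure_wordAt [IsProbabilityMeasure μ]
    (hX : IsStationaryRenewalProcess X ν μ)
    (hν : IsNonLattice ν) (σ : List Bool) :
    μ {ω | X 0 ω = 1 ∧ WordAt X σ 1 ω} =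
      μ {ω | X 0 ω = 1} * ENNReal.ofReal (wordWeight (fun k => ν.real {k + 1}) σ 0) := by
  have := hX.isProbabilityMeasure hν
  have hone : MeasurableSet {ω | X 0 ω = 1} := hX.measurable 0 (measurableSet_singleton 1)
  have hweight : ∀ c, ((jumpSets σ c).map ν).prod =
      ENNReal.ofReal (wordWeight (fun k => ν.real {k + 1}) σ c) := by
    induction σ with
    | nil =>
      intro c
      simp [jumpSets, wordWeight, hX.tailSeq_eq hν]
    | cons b σ ih =>
      intro c
      cases b with
      | false => exact ih (c + 1)
      | true =>
        rw [jumpSets, List.map_cons, List.prod_cons, ih, wordWeight,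
          ENNReal.ofReal_mul measureReal_nonneg, ofReal_measureReal]
  have hword : cond μ {ω | X 0 ω = 1} {ω | WordAt X σ 1 ω} =
      cond μ {ω | X 0 ω = 1} {ω | JumpsIn X (jumpSets σ 0) 0 ω} := by
    refine measure_congr ?_
    filter_upwards [hX.ae_infinite, ae_cond_mem hone] with ω hω h0
    refine propext ?_
    change WordAt X σ 1 ω ↔ JumpsIn X (jumpSets σ 0) 0 ω
    have h1 : onePos X 0 ω = 0 := Nat.nth_zero_of_zero (p := fun n : ℕ => X n ω = 1) h0
    have h2 : 0 < jump X 0 ω := Nat.sub_pos_of_lt (onePos_lt_onePos_succ hω 0)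
    rw [← wordAt_iff_jumpsIn hω, h1]
    simp [h2]
  rw [← hweight, ← measure_jumpsIn hX, ← hword, mul_comm, cond_mul_eq_inter hone]
  rfl

/-- Aperiodicity of the jump law, in terms of roots of unity. -/
theorem IsNonLattice.eq_one_of_pow_eq_one [IsProbabilityMeasure ν] (hν : IsNonLattice ν)
    (hν0 : ν {0} = 0) (z : ℂ) (hz : ∀ k, ν.real {k + 1} ≠ 0 → z ^ (k + 1) = 1) : z = 1 := by
  have hz' : ∀ t : ℕ, ν {t} ≠ 0 → z ^ t = 1 := by
    intro t ht
    cases t with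
    | zero => simp
    | succ k => exact hz k (ENNReal.toReal_ne_zero.2 ⟨ht, measure_ne_top _ _⟩)
  have h0 : z ≠ 0 := by
    rintro rfl
    have h1 : ∀ t : ℕ, ν {t} = 0 := by
      intro t
      by_contra ht
      have := hz' t ht
      rcases Nat.eq_zero_or_pos t with rfl | hpos
      · exact ht hν0
      · simp [hpos.ne'] at this
    have h2 : ν = 0 := Measure.ext_of_singleton (by simpa using h1)
    exact IsProbabilityMeasure.ne_zero ν h2
  have h1 := hν
    { carrier := {t : ℤ | z ^ t = 1}
      zero_mem' := zpow_zero z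
      add_mem' := fun {a b} ha hb => by
        rw [Set.mem_ofPred_eq] at ha hb ⊢
        rw [zpow_add₀ h0, ha, hb, one_mul]
      neg_mem' := fun {a} ha => by
        rw [Set.mem_ofPred_eq] at ha ⊢
        rw [zpow_neg, ha, inv_one] } fun t ht => by
      change z ^ (t : ℤ) = 1
      rw [zpow_natCast]
      exact hz' t ht
  have h2 : (1 : ℤ) ∈ (⊤ : AddSubgroup ℤ) := AddSubgroup.mem_top 1
  rw [← h1] at h2
  have h3 : z ^ (1 : ℤ) = 1 := h2
  simpa using h3

end Renewal

/-! ### The theorem -/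

theorem theorem2 {Ω : Type*} [MeasurableSpace Ω] (μ : Measure Ω) [IsProbabilityMeasure μ]
    (X : ℤ → Ω → Fin 2) (ν : Measure ℕ) (hX : IsStationaryRenewalProcess X ν μ)
    (h_nonlattice : IsNonLattice ν)
    (h_tails : HasExponentialTails (fun t : ℕ => (t : WithTop ℕ)) ν) :
    IsFinitaryFactorOfIIDWithExponentialTails X μ := by
  have := hX.isProbabilityMeasure h_nonlattice
  obtain ⟨C, c, hC, hc, htail⟩ := h_tails
  set v : ℕ → ℝ := fun k => ν.real {k + 1} with hv
  have hv0 : ∀ k, 0 ≤ v k := fun k => measureReal_nonneg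
  have htailSeq : ∀ n, tailSeq v n ≤ C * Real.exp (-c) ^ (n + 1) := by
    intro n
    rw [hX.tailSeq_eq h_nonlattice, ← Real.exp_nat_mul]
    have h1 := htail (n + 1) (by omega)
    have h2 : {t : ℕ | ((n + 1 : ℕ) : WithTop ℕ) ≤ t} = Set.Ioi n := by
      ext t; rw [Set.mem_ofPred_eq, Nat.cast_le]; rfl
    rw [h2] at h1
    rwa [mul_comm (((n + 1 : ℕ)) : ℝ)]
  have hexp : Real.exp (-c) < 1 := Real.exp_lt_one_iff.2 (by linarith)
  have hsum : HasSum v 1 := by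
    rw [hasSum_iff_tendsto_nat_of_nonneg hv0]
    have h1 : Filter.Tendsto (tailSeq v) Filter.atTop (nhds 0) := by
      refine squeeze_zero (fun n => ?_) htailSeq ?_
      · rw [hX.tailSeq_eq h_nonlattice]; exact measureReal_nonneg
      · have := (tendsto_pow_atTop_nhds_zero_of_lt_one (Real.exp_pos _).le hexp).comp
          (Filter.tendsto_add_atTop_nat 1)
        simpa using this.const_mul C
    simpa [tailSeq] using h1.const_sub 1
  obtain ⟨K, p, m, hp0, hp1, hm1, hm0, hm⟩ := exists_geometric_embedding hv0 hsum
    (h_nonlattice.eq_one_of_pow_eq_one hX.measure_zero) (Real.one_lt_exp_iff.2 hc) (C := C)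
    fun n => by
      have h1 : Real.exp (-c) * Real.exp c = 1 := by rw [← Real.exp_add]; simp
      calc tailSeq v n * Real.exp c ^ n ≤ C * Real.exp (-c) ^ (n + 1) * Real.exp c ^ n := by
            gcongr; exact htailSeq n
        _ = C * Real.exp (-c) * (Real.exp (-c) * Real.exp c) ^ n := by rw [mul_pow]; ring
        _ ≤ C := by
          rw [h1, one_pow, mul_one]
          exact mul_le_of_le_one_right hC.le hexp.le
  obtain ⟨ρ, k, hρ, hcoin, hstep, hk0, hk1, hk⟩ := exists_siteLaw hv0 hp0 hp1 hm0 hm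
  have h : IsSiteLaw v m K p ρ k :=
    ⟨hv0, hsum, hp0, hp1, hm1, hm0, hm, hρ, hcoin, hstep, hk0, hk1, hk⟩
  obtain ⟨a, ha⟩ := h.exists_measure_wordAt
  have hzero : fine K 0 = fineZero K := by
    funext ω; simp only [fine, zero_add]
  refine ⟨ℤ → SiteValue, inferInstance, Measure.infinitePi fun _ => ρ, inferInstance, SiteValue,
    inferInstance, inferInstance, fun n ω => ω n, measurable_eval, fine K, codingWindow K,
    ⟨?_, fun i j => ?_⟩, ?_, ⟨fineZero K, measurable_fineZero K, fun n ω => rfl⟩,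
    ⟨isStoppingTime_codingWindow K, ?_, ?_⟩, h.hasExponentialTails_codingWindow⟩
  · exact iIndepFun_infinitePi (X := fun _ ω => ω) fun _ => measurable_id
  · refine ⟨(measurable_eval i).aemeasurable, (measurable_eval j).aemeasurable, ?_⟩
    rw [Measure.infinitePi_map_eval, Measure.infinitePi_map_eval]
  · refine identDistrib_of_measure_one_wordAt hX.measurable (measurable_fine K) hX.stationary
      (isStationaryProcess_fine K) ?_ ?_ (fun σ => ENNReal.ofReal (wordWeight v σ 0)) _ a
      (hX.measure_wordAt h_nonlattice) ha
    · filter_upwards [hX.recurrent] with ω hω using (hω 0).2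
    · filter_upwards [h.ae_exists_fine] with ω hω using hω 0
  · filter_upwards [h.ae_exists_isWindow] with ω ⟨j, hj⟩ htop
    have := codingWindow_le_iff.2 ⟨j, le_rfl, hj⟩
    rw [htop, top_le_iff] at this
    exact WithTop.natCast_ne_top _ this
  · rw [hzero]
    exact measurable_fineZero_stopped K
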